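/- Let $r:\mathbb Z_{\ge 0}\to\mathbb Z_{>0}$ satisfy $r(0)=1$ and $r(m)\le r(m+1)\le r(m)+1$ for all $m\ge 0$, and let $X_1,X_2,\dots$ be i.i.d. random variables with the exponential distribution of rate $1$ (the values of candidates examined one by one). Candidates are accepted by the following rule: if $m\ge 0$ candidates have been accepted so far, the next candidate is accepted if and only if her value exceeds the threshold $Y_m$, the $r(m)$-th largest of the $m$ values accepted so far, with $Y_m:=0$ if $r(m)=m+1$. Let $M_n$ be the number of candidates accepted among the first $n$; for real $x$ let $M_n^{\le x}$ be the number of those accepted candidates among the first $n$ whose value is at most $x$; and let $Y^*_n:=Y_{M_{n-1}}$ be the current threshold when candidate $n$ is examined. Suppose that for some $\alpha\in(0,1)$ $$\sum_{m=1}^\infty\Bigl|\frac1{r(m)}-\frac1{\alpha m}\Bigr|<\infty .$$ Then, almost surely, for every $u\in\mathbb R$, $$\frac{M_n^{\le Y^*_n+u}}{M_n}\to F(u):=\begin{cases}(1-\alpha)e^{\alpha u/(1-\alpha)},&u\le 0,\\ 1-\alpha e^{-u},&u\ge 0,\end{cases}\qquad n\to\infty .$$ The function $F$ is the distribution function of a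 probability measure $\nu$ on $\mathbb R$, the asymmetric Laplace law with density $\alpha e^{\alpha u/(1-\alpha)}$ for $u<0$ and $\alpha e^{-u}$ for $u>0$. Almost surely, the empirical distribution of the differences $X_k-Y^*_n$, taken over the $M_n$ candidates $k\le n$ that are accepted, converges weakly to $\nu$ as $n\to\infty$. Hence, if $\bar X_n$ is the value of one of the $M_n$ accepted candidates among the first $n$, chosen uniformly at random (given $X_1,\dots,X_n$), then $\bar X_n-Y^*_n$ converges in distribution to $\nu$. -/

import Mathlib

open Filter Topology MeasureTheory ProbabilityTheory
open scoped BoundedContinuousFunction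

noncomputable section

namespace Hiring

/-- The standing assumption on a rank sequence: `r 0 = 1` and `r m ≤ r (m + 1) ≤ r m + 1`. -/
def IsRankSequence (r : ℕ → ℕ) : Prop :=
  r 0 = 1 ∧ ∀ m, r m ≤ r (m + 1) ∧ r (m + 1) ≤ r m + 1

/-- The `j`-th largest (`j ≥ 1`) of the values `x i`, `i ∈ S`, counted with multiplicity;
it is `0` if there are fewer than `j` of them. -/
def kthLargest (x : ℕ → ℝ) (S : Finset ℕ) (j : ℕ) : ℝ :=
  ((S.val.map x).sort (· ≥ ·)).getD (j - 1) 0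

/-- The threshold `Y_m` when the set of (indices of) accepted candidates is `S` and `m = #S`:
the `r m`-th largest accepted value, and `0` if `r m = m + 1`. -/
def threshold (r : ℕ → ℕ) (x : ℕ → ℝ) (S : Finset ℕ) : ℝ :=
  kthLargest x S (r S.card)

/-- The candidates are numbered `1, 2, …`, and `x i` is the value of candidate `i + 1`.
`accepted r x n` is the set of those `i < n` for which candidate `i + 1` is accepted: a candidate
is accepted if and only if her value exceeds the threshold given by the candidates accepted
before her. -/
def accepted (r : ℕ → ℕ) (x : ℕ → ℝ) : ℕ → Finset ℕ
  | 0 => ∅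
  | n + 1 =>
    if threshold r x (accepted r x n) < x n then insert n (accepted r x n) else accepted r x n

/-- `M_n`: the number of candidates accepted among the first `n`. -/
def numAccepted (r : ℕ → ℕ) (x : ℕ → ℝ) (n : ℕ) : ℕ := (accepted r x n).card

/-- The number of values at most `y` accepted among the first `n` candidates. -/
def numAcceptedLE (r : ℕ → ℕ) (x : ℕ → ℝ) (n : ℕ) (y : ℝ) : ℕ :=
  ((accepted r x n).filter (fun i => x i ≤ y)).card

/-- The current threshold `Y_{M_{n-1}}` when candidate `n` (`n ≥ 1`) is examined. -/
def currentThreshold (r : ℕ → ℕ) (x : ℕ → ℝ) (n : ℕ) : ℝ :=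
  threshold r x (accepted r x (n - 1))

/-- The empirical distribution of the differences between the values accepted among the first `n`
candidates and the current threshold (the zero measure if nobody has been accepted). -/
def empiricalLaw (r : ℕ → ℕ) (x : ℕ → ℝ) (n : ℕ) : Measure ℝ :=
  (numAccepted r x n : ENNReal)⁻¹ •
    ∑ i ∈ accepted r x n, Measure.dirac (x i - currentThreshold r x n)

/-- The sigma-algebra generated by the values of the first `n` candidates. -/
abbrev sigmaValues {Ω : Type*} (X : ℕ → Ω → ℝ) (n : ℕ) : MeasurableSpace Ω :=
  MeasurableSpace.comap (fun ω (i : Fin n) => X i ω) MeasurableSpace.pi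

/-- The (measurable) `K` picks the index of one of the candidates accepted among the first `n`, uniformly at
random: given the values of the first `n` candidates, each accepted index has conditional
probability `1 / M_n`, and each other index has conditional probability `0`. -/
def IsUniformPick {Ω : Type*} [MeasurableSpace Ω] (P : Measure Ω) (r : ℕ → ℕ)
    (X : ℕ → Ω → ℝ) (n : ℕ) (K : Ω → ℕ) : Prop :=
  ∀ k : ℕ,
    P[(K ⁻¹' {k}).indicator (fun _ => (1 : ℝ)) | sigmaValues X n] =ᵐ[P]
      fun ω => if k ∈ accepted r (fun i => X i ω) n
        then 1 / (numAccepted r (fun i => X i ω) n : ℝ) else 0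

/-- The limiting distribution function. -/
def limitCDF (α u : ℝ) : ℝ :=
  if u ≤ 0 then (1 - α) * Real.exp (α * u / (1 - α)) else 1 - α * Real.exp (-u)

/-- The density of the asymmetric Laplace law. -/
def limitDensity (α u : ℝ) : ℝ :=
  if u ≤ 0 then α * Real.exp (α * u / (1 - α)) else α * Real.exp (-u)

end Hiring

end

noncomputable section

namespace Hiring

/-! ### Order statistics -/

/-! Write `T_n` for the threshold after `n` candidates. Since `r` grows by at most one per
acceptance, `T_n` is nondecreasing. Two facts follow. Every value above `T_n` was accepted, so `T_n`
is the `r(M_n)`-th largest of all `n` values (`numAbove_thresholdAfter`). And the set of accepted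
values at most `T_a` is frozen after time `a` (`numAcceptedLE_thresholdAfter`).

Summability enters only through `r(m)/m → α` (`IsRankSequence.tendsto_div`). A law of large numbers
uniform in the level (`HasUniformTail`) then turns the count `r(M_n) - 1 ~ α M_n` above `T_n` into
`n e^{-T_n} ~ α M_n` (`tendsto_mul_exp_div`). Above the threshold this settles the matter: about `n
e^{-T_n-u} ~ α e^{-u} M_n` accepted values exceed `T_n + u`.

Below the threshold, let `b/a → ρ`. Acceptances between `a` and `b` include all new values above
`T_b` and have values above `T_a`, so `M_b/M_a` is asymptotically at most `1 + α(ρ-1)` and `M_a/M_b`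
at most `1 + α(ρ⁻¹-1)`. Splitting a ratio `c` into `K` equal factors and letting `K → ∞` gives
`M_b/M_a → c^α` (`tendsto_numAccepted_div`), hence `T_b - T_a → (1-α) log c`. At time `b` the
fraction of accepted values at most `T_a` is therefore about `(1-α) M_a/M_b → (1-α) c^{-α}`, which
is `F(u)` for `u = -(1-α) log c`.

All of this is deterministic for a sequence satisfying `IsTypical`. Probability enters in proving
that almost every sequence is typical: Chernoff bounds and Borel–Cantelli on a geometric grid give
the uniform tail, and records, which are always accepted, give a crude growth bound on `M_n`. The
random pick is treated by conditioning on the values and dominated convergence. -/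

/-- In a decreasing list the entries satisfying an upward closed predicate form an initial segment.
-/
theorem pred_getElem_iff_lt_countP {p : ℝ → Bool} (hp : ∀ a b, a ≤ b → p a → p b) :
    ∀ (l : List ℝ), l.Pairwise (· ≥ ·) → ∀ j (h : j < l.length),
      p l[j] = true ↔ j < l.countP p := by
  intro l
  induction l with
  | nil => intro _ j h; simp at h
  | cons a l ih =>
    intro hl j h
    rw [List.pairwise_cons] at hl
    by_cases ha : p a = true
    · rw [List.countP_cons_of_pos ha]
      cases j with
      | zero => simp [ha]
      | succ j =>
        have := ih hl.2 j (by simpa using h)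
        simpa using this
    · have h0 : ∀ b ∈ a :: l, ¬ p b = true := by
        intro b hb hpb
        rcases List.mem_cons.1 hb with rfl | hb
        · exact ha hpb
        · exact ha (hp b a (hl.1 b hb) hpb)
      rw [List.countP_eq_zero.2 h0]
      simpa using h0 _ (List.getElem_mem h)

/-- Upward closed predicates cover the strict and the weak comparison with a level at once;
afterwards sorting is no longer needed, only counting. -/
theorem pred_kthLargest_iff (x : ℕ → ℝ) (S : Finset ℕ) {p : ℝ → Prop} [DecidablePred p]
    (hp : ∀ a b, a ≤ b → p a → p b) {j : ℕ} (hj : 1 ≤ j) (hjS : j ≤ S.card) :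
    p (kthLargest x S j) ↔ j ≤ (S.filter fun i => p (x i)).card := by
  set l := (S.val.map x).sort (· ≥ ·) with hl
  have hlen : l.length = S.card := by simp [hl]
  have hlt : j - 1 < l.length := by omega
  have hget : kthLargest x S j = l[j - 1] := by
    rw [kthLargest, ← hl, List.getD_eq_getElem _ _ hlt]
  have hcount : l.countP (fun a => decide (p a)) = (S.filter fun i => p (x i)).card := by
    have h1 : Multiset.countP p (l : Multiset ℝ) = Multiset.countP p (S.val.map x) := by
      rw [hl, Multiset.sort_eq]
    rw [Multiset.coe_countP, Multiset.countP_map] at h1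
    rw [h1]; rfl
  have := pred_getElem_iff_lt_countP (p := fun a => decide (p a))
    (by simpa using hp) l ((S.val.map x).pairwise_sort (· ≥ ·)) (j - 1) hlt
  rw [hget, ← hcount]
  simp only [decide_eq_true_eq] at this
  rw [this]; omega

theorem lt_kthLargest_iff (x : ℕ → ℝ) (S : Finset ℕ) {j : ℕ} (hj : 1 ≤ j) (hjS : j ≤ S.card)
    (y : ℝ) : y < kthLargest x S j ↔ j ≤ (S.filter fun i => y < x i).card :=
  pred_kthLargest_iff x S (p := fun a => y < a) (fun _ _ h h' => h'.trans_le h) hj hjS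

theorem le_kthLargest_iff (x : ℕ → ℝ) (S : Finset ℕ) {j : ℕ} (hj : 1 ≤ j) (hjS : j ≤ S.card)
    (y : ℝ) : y ≤ kthLargest x S j ↔ j ≤ (S.filter fun i => y ≤ x i).card :=
  pred_kthLargest_iff x S (p := fun a => y ≤ a) (fun _ _ h h' => le_trans h' h) hj hjS

theorem kthLargest_of_card_lt (x : ℕ → ℝ) (S : Finset ℕ) {j : ℕ} (hj : S.card < j) :
    kthLargest x S j = 0 := by
  rw [kthLargest, List.getD_eq_default]
  simp; omega

theorem card_filter_kthLargest_lt {x : ℕ → ℝ} (hx : Function.Injective x) (S : Finset ℕ) {j : ℕ}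
    (hj : 1 ≤ j) (hjS : j ≤ S.card) :
    (S.filter fun i => kthLargest x S j < x i).card = j - 1 := by
  set T := kthLargest x S j with hT
  have h1 : ¬ j ≤ (S.filter fun i => T < x i).card := by
    rw [← lt_kthLargest_iff x S hj hjS, ← hT]; exact lt_irrefl _
  have h2 : j ≤ (S.filter fun i => T ≤ x i).card :=
    (le_kthLargest_iff x S hj hjS T).1 hT.le
  have h3 : (S.filter fun i => T ≤ x i).card ≤
      (S.filter fun i => T < x i).card + (S.filter fun i => x i = T).card := by
    rw [← Finset.card_union_of_disjoint]
    · apply Finset.card_le_card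
      intro i hi
      simp only [Finset.mem_filter, Finset.mem_union] at hi ⊢
      rcases hi.2.lt_or_eq with h | h
      · exact Or.inl ⟨hi.1, h⟩
      · exact Or.inr ⟨hi.1, h.symm⟩
    · rw [Finset.disjoint_filter]
      intro i _ h h'
      exact h.ne' h'
  have h4 : (S.filter fun i => x i = T).card ≤ 1 := by
    rw [Finset.card_le_one]
    intro a ha b hb
    simp only [Finset.mem_filter] at ha hb
    exact hx (ha.2.trans hb.2.symm)
  omega

/-! ### Rank sequences -/

theorem IsRankSequence.monotone {r : ℕ → ℕ} (hr : IsRankSequence r) : Monotone r :=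
  monotone_nat_of_le_succ fun m => (hr.2 m).1

theorem IsRankSequence.one_le {r : ℕ → ℕ} (hr : IsRankSequence r) (m : ℕ) : 1 ≤ r m :=
  hr.1 ▸ hr.monotone (Nat.zero_le m)

theorem IsRankSequence.add_le {r : ℕ → ℕ} (hr : IsRankSequence r) (m k : ℕ) :
    r (m + k) ≤ r m + k := by
  induction k with
  | zero => simp
  | succ k ih => have := (hr.2 (m + k)).2; rw [← add_assoc]; omega

theorem IsRankSequence.le_succ {r : ℕ → ℕ} (hr : IsRankSequence r) (m : ℕ) : r m ≤ m + 1 := by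
  have := hr.add_le 0 m
  rw [hr.1, zero_add] at this; omega

/-! ### The accepted candidates -/

/-- The threshold after the first `n` candidates have been examined. -/
def thresholdAfter (r : ℕ → ℕ) (x : ℕ → ℝ) (n : ℕ) : ℝ := threshold r x (accepted r x n)

/-- The number of values exceeding `y` among the first `n` values. -/
def numAbove (x : ℕ → ℝ) (n : ℕ) (y : ℝ) : ℕ := ((Finset.range n).filter fun i => y < x i).card

theorem numAbove_mono_left (x : ℕ → ℝ) (y : ℝ) : Monotone fun n => numAbove x n y := by
  intro a b hab
  exact Finset.card_le_card (Finset.filter_subset_filter _ (Finset.range_mono hab))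

theorem numAbove_anti_right (x : ℕ → ℝ) (n : ℕ) : Antitone (numAbove x n) := by
  intro y z hyz
  exact Finset.card_le_card (Finset.monotone_filter_right _ fun i _ h => lt_of_le_of_lt hyz h)

section Deterministic

variable {r : ℕ → ℕ} {x : ℕ → ℝ}

theorem accepted_succ_of_lt {n : ℕ} (h : thresholdAfter r x n < x n) :
    accepted r x (n + 1) = insert n (accepted r x n) := by
  rw [accepted]; exact if_pos h

theorem accepted_succ_of_not_lt {n : ℕ} (h : ¬ thresholdAfter r x n < x n) :
    accepted r x (n + 1) = accepted r x n := by
  rw [accepted]; exact if_neg h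

theorem accepted_subset_range (r : ℕ → ℕ) (x : ℕ → ℝ) (n : ℕ) :
    accepted r x n ⊆ Finset.range n := by
  induction n with
  | zero => simp [accepted]
  | succ n ih =>
    have h : accepted r x n ⊆ Finset.range (n + 1) :=
      ih.trans (Finset.range_mono (Nat.le_succ n))
    by_cases hn : thresholdAfter r x n < x n
    · rw [accepted_succ_of_lt hn]
      exact Finset.insert_subset (by simp) h
    · rwa [accepted_succ_of_not_lt hn]

theorem notMem_accepted_of_le {n k : ℕ} (h : n ≤ k) : k ∉ accepted r x n := fun hk => by
  have := accepted_subset_range r x n hk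
  simp at this; omega

theorem accepted_mono (r : ℕ → ℕ) (x : ℕ → ℝ) : Monotone (accepted r x) := by
  refine monotone_nat_of_le_succ fun n => ?_
  by_cases hn : thresholdAfter r x n < x n
  · rw [accepted_succ_of_lt hn]; exact Finset.subset_insert _ _
  · rw [accepted_succ_of_not_lt hn]

theorem numAccepted_succ_le (r : ℕ → ℕ) (x : ℕ → ℝ) (n : ℕ) :
    numAccepted r x (n + 1) ≤ numAccepted r x n + 1 := by
  unfold numAccepted
  by_cases hn : thresholdAfter r x n < x n
  · rw [accepted_succ_of_lt hn]; exact Finset.card_insert_le _ _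
  · rw [accepted_succ_of_not_lt hn]; omega

theorem numAccepted_mono (r : ℕ → ℕ) (x : ℕ → ℝ) : Monotone (numAccepted r x) :=
  fun _ _ h => Finset.card_le_card (accepted_mono r x h)

theorem numAcceptedLE_mono (r : ℕ → ℕ) (x : ℕ → ℝ) (n : ℕ) : Monotone (numAcceptedLE r x n) :=
  fun _ _ h => Finset.card_le_card
    (Finset.monotone_filter_right _ fun _ _ h' => le_trans h' h)

theorem numAcceptedLE_mono_left (r : ℕ → ℕ) (x : ℕ → ℝ) (y : ℝ) :
    Monotone fun n => numAcceptedLE r x n y :=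
  fun _ _ h => Finset.card_le_card (Finset.filter_subset_filter _ (accepted_mono r x h))

theorem numAcceptedLE_succ_le (r : ℕ → ℕ) (x : ℕ → ℝ) (n : ℕ) (y : ℝ) :
    numAcceptedLE r x (n + 1) y ≤ numAcceptedLE r x n y + 1 := by
  unfold numAcceptedLE
  by_cases hn : thresholdAfter r x n < x n
  · rw [accepted_succ_of_lt hn, Finset.filter_insert]
    split_ifs
    · exact Finset.card_insert_le _ _
    · omega
  · rw [accepted_succ_of_not_lt hn]; omega

theorem thresholdAfter_of_card_lt (n : ℕ)
    (h : numAccepted r x n < r (numAccepted r x n)) : thresholdAfter r x n = 0 :=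
  kthLargest_of_card_lt x _ h

/-- An acceptance raises the count above every level below `x n` by one, and the rank by at most
one. If the new threshold were lower than the old one, at least `r (m + 1)` accepted values would
exceed it, contradicting its rank. Positivity of the values handles the default threshold `0`. -/
theorem thresholdAfter_le_succ (hr : IsRankSequence r) (hpos : ∀ i, 0 < x i) (n : ℕ) :
    thresholdAfter r x n ≤ thresholdAfter r x (n + 1) := by
  by_cases hn : thresholdAfter r x n < x n
  swap
  · unfold thresholdAfter; rw [accepted_succ_of_not_lt hn]
  have hacc := accepted_succ_of_lt hn
  have hnot : n ∉ accepted r x n := notMem_accepted_of_le le_rfl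
  set m := (accepted r x n).card with hm
  have hm' : (accepted r x (n + 1)).card = m + 1 := by
    rw [hacc, Finset.card_insert_of_notMem hnot]
  have hrm := hr.2 m
  by_contra! hlt
  have hT' : thresholdAfter r x (n + 1) = kthLargest x (accepted r x (n + 1)) (r (m + 1)) := by
    rw [thresholdAfter, threshold, hm']
  have hcard : (accepted r x n).card + 1 = (accepted r x (n + 1)).card := by omega
  have hadd : ∀ y, y < x n → ((accepted r x (n + 1)).filter fun i => y < x i).card =
      ((accepted r x n).filter fun i => y < x i).card + 1 := by
    intro y hy
    rw [hacc, Finset.filter_insert, if_pos hy, Finset.card_insert_of_notMem]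
    simp [hnot]
  by_cases hcase : r m ≤ m
  · have hT : thresholdAfter r x n = kthLargest x (accepted r x n) (r m) := rfl
    have h1 := (lt_kthLargest_iff x _ (hr.one_le m) (hm ▸ hcase) _).1 (hT ▸ hlt)
    have h2 := hadd _ (hlt.trans hn)
    have h3 := (lt_kthLargest_iff x (accepted r x (n + 1)) (hr.one_le (m + 1)) (by omega)
      (thresholdAfter r x (n + 1))).2 (by omega)
    exact lt_irrefl _ (hT' ▸ h3)
  · have hT : thresholdAfter r x n = 0 := thresholdAfter_of_card_lt n (by
      change m < r m; omega)
    rw [hT] at hlt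
    by_cases hcase' : r (m + 1) ≤ m + 1
    · have h3 := (lt_kthLargest_iff x (accepted r x (n + 1)) (hr.one_le (m + 1)) (by omega)
        (thresholdAfter r x (n + 1))).2 (by
          rw [Finset.filter_true_of_mem (fun i _ => hlt.trans (hpos i))]; omega)
      exact lt_irrefl _ (hT' ▸ h3)
    · rw [hT', kthLargest_of_card_lt x _ (by omega)] at hlt
      exact lt_irrefl _ hlt

theorem thresholdAfter_mono (hr : IsRankSequence r) (hpos : ∀ i, 0 < x i) :
    Monotone (thresholdAfter r x) :=
  monotone_nat_of_le_succ (thresholdAfter_le_succ hr hpos)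

theorem thresholdAfter_nonneg (hr : IsRankSequence r) (hpos : ∀ i, 0 < x i) (n : ℕ) :
    0 ≤ thresholdAfter r x n := by
  refine le_trans (le_of_eq ?_) (thresholdAfter_mono hr hpos (Nat.zero_le n))
  refine (thresholdAfter_of_card_lt 0 ?_).symm
  have h0 : numAccepted r x 0 = 0 := rfl
  rw [h0, hr.1]; exact one_pos

/-- Every value exceeding the current threshold belongs to an accepted candidate. -/
theorem mem_accepted_of_thresholdAfter_lt (hr : IsRankSequence r) (hpos : ∀ i, 0 < x i)
    {n i : ℕ} (hi : i < n) (h : thresholdAfter r x n < x i) : i ∈ accepted r x n := by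
  have h1 : thresholdAfter r x i < x i :=
    (thresholdAfter_mono hr hpos hi.le).trans_lt h
  apply accepted_mono r x (Nat.succ_le_of_lt hi)
  rw [Nat.succ_eq_add_one, accepted_succ_of_lt h1]
  exact Finset.mem_insert_self _ _

theorem filter_accepted_eq (hr : IsRankSequence r) (hpos : ∀ i, 0 < x i) {n : ℕ} {y : ℝ}
    (hy : thresholdAfter r x n ≤ y) :
    (accepted r x n).filter (fun i => y < x i) = (Finset.range n).filter fun i => y < x i := by
  ext i
  simp only [Finset.mem_filter, Finset.mem_range]
  constructor
  · rintro ⟨h1, h2⟩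
    exact ⟨Finset.mem_range.1 (accepted_subset_range r x n h1), h2⟩
  · rintro ⟨h1, h2⟩
    exact ⟨mem_accepted_of_thresholdAfter_lt hr hpos h1 (hy.trans_lt h2), h2⟩

theorem numAcceptedLE_add_numAbove (hr : IsRankSequence r) (hpos : ∀ i, 0 < x i) {n : ℕ} {y : ℝ}
    (hy : thresholdAfter r x n ≤ y) :
    numAcceptedLE r x n y + numAbove x n y = numAccepted r x n := by
  rw [numAbove, ← filter_accepted_eq hr hpos hy, numAcceptedLE, numAccepted]
  simp only [← not_le]
  exact Finset.card_filter_add_card_filter_not _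

/-- The threshold is the `r(M)`-th largest of all the values examined so far. -/
theorem numAbove_thresholdAfter (hr : IsRankSequence r) (hpos : ∀ i, 0 < x i)
    (hx : Function.Injective x) (n : ℕ) :
    numAbove x n (thresholdAfter r x n) + 1 = r (numAccepted r x n) := by
  rw [numAbove, ← filter_accepted_eq hr hpos le_rfl]
  have h1 := hr.one_le (numAccepted r x n)
  by_cases h : r (numAccepted r x n) ≤ numAccepted r x n
  · have := card_filter_kthLargest_lt hx (accepted r x n) h1 h
    have h2 : thresholdAfter r x n =
      kthLargest x (accepted r x n) (r (numAccepted r x n)) := rfl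
    rw [← h2] at this
    omega
  · have h2 := hr.le_succ (numAccepted r x n)
    rw [thresholdAfter_of_card_lt n (by omega),
      Finset.filter_true_of_mem fun i _ => hpos i]
    change numAccepted r x n + 1 = _
    omega

/-- Anyone accepted after time `a` beats a later threshold, hence the one at time `a`, so nothing is
added at or below it. -/
theorem numAcceptedLE_thresholdAfter (hr : IsRankSequence r) (hpos : ∀ i, 0 < x i) {a n : ℕ}
    (han : a ≤ n) : numAcceptedLE r x n (thresholdAfter r x a) =
      numAcceptedLE r x a (thresholdAfter r x a) := by
  unfold numAcceptedLE
  congr 1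
  ext i
  simp only [Finset.mem_filter]
  refine ⟨fun h => ⟨?_, h.2⟩, fun h => ⟨accepted_mono r x han h.1, h.2⟩⟩
  induction n, han using Nat.le_induction with
  | base => exact h.1
  | succ n han ih =>
    by_cases hn : thresholdAfter r x n < x n
    · rw [accepted_succ_of_lt hn, Finset.mem_insert] at h
      rcases h.1 with rfl | h1
      · exact absurd h.2 (not_le.2 ((thresholdAfter_mono hr hpos han).trans_lt hn))
      · exact ih ⟨h1, h.2⟩
    · rw [accepted_succ_of_not_lt hn] at h
      exact ih h

/-- Candidates accepted between `a` and `b` all have values above the threshold at time `a`.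
Additions on both sides avoid natural subtraction. -/
theorem numAccepted_add_numAbove_le (hr : IsRankSequence r) (hpos : ∀ i, 0 < x i) {a b : ℕ}
    (hab : a ≤ b) : numAccepted r x b + numAbove x a (thresholdAfter r x a) ≤
      numAccepted r x a + numAbove x b (thresholdAfter r x a) := by
  have h1 := numAcceptedLE_add_numAbove hr hpos (le_refl (thresholdAfter r x a))
  have h2 := numAcceptedLE_thresholdAfter hr hpos hab (r := r) (x := x)
  have h3 : numAccepted r x b ≤
      numAcceptedLE r x b (thresholdAfter r x a) + numAbove x b (thresholdAfter r x a) := by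
    rw [numAccepted, numAcceptedLE,
      ← Finset.card_filter_add_card_filter_not (s := accepted r x b)
        (fun i => x i ≤ thresholdAfter r x a)]
    simp only [not_le]
    gcongr
    exact Finset.card_le_card (Finset.filter_subset_filter _ (accepted_subset_range r x b))
  omega

/-- Conversely, every value between `a` and `b` above the threshold at time `b` is accepted. -/
theorem numAccepted_add_numAbove_ge (hr : IsRankSequence r) (hpos : ∀ i, 0 < x i) {a b : ℕ}
    (hab : a ≤ b) : numAccepted r x a + numAbove x b (thresholdAfter r x b) ≤
      numAccepted r x b + numAbove x a (thresholdAfter r x b) := by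
  have h1 := numAcceptedLE_add_numAbove hr hpos (le_refl (thresholdAfter r x b))
  have h2 := numAcceptedLE_add_numAbove hr hpos (thresholdAfter_mono hr hpos hab)
  have h3 := numAcceptedLE_mono_left r x (thresholdAfter r x b) hab
  simp only at h3
  omega

theorem thresholdAfter_le_of_forall_le (hr : IsRankSequence r) {n : ℕ} {y : ℝ} (hy : 0 ≤ y)
    (h : ∀ i < n, x i ≤ y) : thresholdAfter r x n ≤ y := by
  by_cases hc : r (numAccepted r x n) ≤ numAccepted r x n
  · have h1 := (le_kthLargest_iff x (accepted r x n) (hr.one_le _) hc (thresholdAfter r x n)).1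
      le_rfl
    obtain ⟨i, hi⟩ := Finset.card_pos.1 ((hr.one_le _).trans h1)
    rw [Finset.mem_filter] at hi
    exact hi.2.trans (h i (Finset.mem_range.1 (accepted_subset_range r x n hi.1)))
  · rwa [thresholdAfter_of_card_lt n (by omega)]

/-- A new maximum among the candidates `a + 1, …, b` forces at least one acceptance. -/
theorem numAccepted_lt_of_numAbove (hr : IsRankSequence r) {a b : ℕ} {y : ℝ} (hy : 0 ≤ y)
    (ha : numAbove x a y = 0) (hb : 0 < numAbove x b y) :
    numAccepted r x a < numAccepted r x b := by
  classical
  have hex : ∃ i, i < b ∧ y < x i := by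
    obtain ⟨i, hi⟩ := Finset.card_pos.1 hb
    exact ⟨i, by simpa using hi⟩
  obtain ⟨hib, hiy⟩ := Nat.find_spec hex
  set i := Nat.find hex
  have hlt : ∀ k < i, x k ≤ y := fun k hk =>
    not_lt.1 fun h => Nat.find_min hex hk ⟨hk.trans hib, h⟩
  have hai : a ≤ i := by
    by_contra! h
    have : i ∈ (Finset.range a).filter fun i => y < x i := by simp [h, hiy]
    rw [Finset.card_eq_zero.1 ha] at this
    simp at this
  have hT := (thresholdAfter_le_of_forall_le hr hy hlt).trans_lt hiy
  have h1 : numAccepted r x (i + 1) = numAccepted r x i + 1 := by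
    rw [numAccepted, accepted_succ_of_lt hT,
      Finset.card_insert_of_notMem (notMem_accepted_of_le le_rfl), numAccepted]
  have h2 := numAccepted_mono r x hai
  have h3 := numAccepted_mono r x (Nat.succ_le_of_lt hib)
  simp only [Nat.succ_eq_add_one] at h3
  omega

end Deterministic

/-! ### Summability implies `r(m)/m → α` -/

/-- A relative deviation `ε` at `m` persists as `ε/2` at every `n` slightly below `m`: a value too
small stays so because `r` is monotone, a value too large because `r` loses at most `m - n` going
back. Each such `n` then contributes a summand of order `ε/(αm)`. -/
theorem IsRankSequence.le_abs_sub_of_not {r : ℕ → ℕ} (hr : IsRankSequence r) {α ε : ℝ}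
    (hα0 : 0 < α) (hα1 : α < 1) (hε : 0 < ε) (hε1 : ε ≤ 1) {m n : ℕ} (hn : 1 ≤ n) (hnm : n ≤ m)
    (hmn : (m : ℝ) - n ≤ ε * α / 2 * m) (h : ¬ |(r m : ℝ) - α * m| ≤ ε * (α * m)) :
    ε / 4 / (α * m) ≤ |1 / (r n : ℝ) - 1 / (α * n)| := by
  have hn0 : (0 : ℝ) < n := by exact_mod_cast hn
  have hnm' : (n : ℝ) ≤ m := by exact_mod_cast hnm
  have hm0 : (0 : ℝ) < m := hn0.trans_le hnm'
  have hr0 : (0 : ℝ) < r n := by exact_mod_cast hr.one_le n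
  have hαn : 0 < α * n := by positivity
  have hαm : 0 < α * m := by positivity
  have hαnm : α * n ≤ α * m := by gcongr
  have hstep : ε / 4 / (α * m) ≤ ε / 4 / (α * n) := by gcongr
  refine hstep.trans ?_
  have key : (1 + ε / 2) * (α * n) ≤ r n ∨ (r n : ℝ) ≤ (1 - ε / 2) * (α * n) := by
    rw [abs_le, not_and_or, not_le, not_le] at h
    rcases h with h | h
    · right
      have h1 : (r n : ℝ) ≤ r m := by exact_mod_cast hr.monotone hnm
      have h2 : (1 - ε * α / 2) * m ≤ n := by linarith
      have h3 : (1 - ε / 2) * (α * ((1 - ε * α / 2) * m)) ≤ (1 - ε / 2) * (α * n) := by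
        gcongr; linarith
      have h4 : (1 - ε) * (α * m) ≤ (1 - ε / 2) * (1 - ε * α / 2) * (α * m) := by
        gcongr
        nlinarith [mul_pos hε hα0, mul_pos hε (sub_pos.2 hα1), mul_pos hε (mul_pos hε hα0)]
      linarith
    · left
      have h1 : (r m : ℝ) ≤ r n + (m - n) := by
        have := hr.add_le n (m - n)
        rw [Nat.add_sub_cancel' hnm] at this
        have h' : ((m - n : ℕ) : ℝ) = m - n := Nat.cast_sub hnm
        rw [← h']
        exact_mod_cast this
      have h5 : (1 + ε / 2) * (α * n) ≤ (1 + ε / 2) * (α * m) := by gcongr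
      linarith
  rcases key with h | h
  · have h1 : 1 / (r n : ℝ) ≤ 1 / ((1 + ε / 2) * (α * n)) := by gcongr
    have h2 : 1 / ((1 + ε / 2) * (α * n)) ≤ (1 - ε / 4) / (α * n) := by
      rw [div_le_div_iff₀ (by positivity) hαn]
      have : 1 ≤ (1 - ε / 4) * (1 + ε / 2) := by nlinarith
      nlinarith
    have h3 : ε / 4 / (α * n) = 1 / (α * n) - (1 - ε / 4) / (α * n) := by ring
    rw [abs_sub_comm]
    refine le_trans ?_ (le_abs_self _)
    linarith
  · have h2 : (1 + ε / 4) / (α * n) ≤ 1 / (r n : ℝ) := by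
      rw [div_le_div_iff₀ hαn hr0]
      have h4 : (1 + ε / 4) * r n ≤ (1 + ε / 4) * ((1 - ε / 2) * (α * n)) := by gcongr
      have : (1 + ε / 4) * (1 - ε / 2) ≤ 1 := by nlinarith
      nlinarith
    have h3 : ε / 4 / (α * n) = (1 + ε / 4) / (α * n) - 1 / (α * n) := by ring
    refine le_trans ?_ (le_abs_self _)
    linarith

theorem IsRankSequence.tendsto_div {r : ℕ → ℕ} (hr : IsRankSequence r) {α : ℝ}
    (hα0 : 0 < α) (hα1 : α < 1)
    (hsum : Summable fun m : ℕ => |1 / (r (m + 1) : ℝ) - 1 / (α * ((m + 1 : ℕ) : ℝ))|) :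
    Tendsto (fun m : ℕ => (r m : ℝ) / m) atTop (𝓝 α) := by
  set f := fun m : ℕ => |1 / (r (m + 1) : ℝ) - 1 / (α * ((m + 1 : ℕ) : ℝ))| with hf
  have key : ∀ ε : ℝ, 0 < ε → ε ≤ 1 →
      ∀ᶠ m : ℕ in atTop, |(r m : ℝ) - α * m| ≤ ε * (α * m) := by
    intro ε hε hε1
    set δ := ε * α / 2 with hδ
    have hδ0 : 0 < δ := by positivity
    have hδ1 : δ < 1 / 2 := by nlinarith
    -- Length of the block ending at `m` on which a deviation at `m` persists. Block sums of a
    -- convergent series tend to `0`, while at least `δm/2` summands of size `ε/(4αm)` would give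
    -- `δε/(8α)`.
    set k : ℕ → ℕ := fun m => ⌊δ * m⌋₊ with hk
    have hkm : ∀ m, (k m : ℝ) ≤ δ * m := fun m => Nat.floor_le (by positivity)
    have hkle : ∀ m, k m ≤ m := fun m => by
      have : (k m : ℝ) ≤ m := (hkm m).trans (by nlinarith [(Nat.cast_nonneg m : (0 : ℝ) ≤ m)])
      exact_mod_cast this
    have hS : Tendsto (fun m => ∑ i ∈ Finset.range m, f i) atTop (𝓝 (∑' i, f i)) :=
      hsum.hasSum.tendsto_sum_nat
    have hsub : Tendsto (fun m => m - k m) atTop atTop := by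
      rw [← tendsto_natCast_atTop_iff (R := ℝ)]
      refine tendsto_atTop_mono (f := fun m : ℕ => (m : ℝ) * (1 / 2)) (fun m => ?_)
        (tendsto_natCast_atTop_atTop.atTop_mul_const (by norm_num))
      rw [Nat.cast_sub (hkle m)]
      nlinarith [hkm m, (Nat.cast_nonneg m : (0 : ℝ) ≤ m)]
    have hdiff : Tendsto (fun m => ∑ i ∈ Finset.Ico (m - k m) m, f i) atTop (𝓝 0) := by
      have := hS.sub (hS.comp hsub)
      rw [sub_self] at this
      refine this.congr fun m => ?_
      rw [Finset.sum_Ico_eq_sub _ (Nat.sub_le _ _)]; rfl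
    have hc : 0 < δ / 2 * (ε / 4 / α) := by positivity
    filter_upwards [hdiff.eventually (gt_mem_nhds hc),
      tendsto_natCast_atTop_atTop.eventually_ge_atTop (2 / δ)] with m hm hmδ
    by_contra hcon
    have hm0 : (0 : ℝ) < m := lt_of_lt_of_le (by positivity) hmδ
    have hlow : ∀ i ∈ Finset.Ico (m - k m) m, ε / 4 / (α * m) ≤ f i := by
      intro i hi
      rw [Finset.mem_Ico] at hi
      refine hr.le_abs_sub_of_not hα0 hα1 hε hε1 (by omega) (by omega) ?_ hcon
      have h1 : m ≤ k m + (i + 1) := by omega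
      have h2 : (m : ℝ) ≤ k m + ((i + 1 : ℕ) : ℝ) := by exact_mod_cast h1
      have h3 := hkm m
      rw [hδ] at h3
      linarith
    have hsumle := Finset.card_nsmul_le_sum _ _ _ hlow
    rw [Nat.card_Ico, Nat.sub_sub_self (hkle m), nsmul_eq_mul] at hsumle
    have h3 : δ / 2 * m ≤ k m := by
      have h4 := Nat.lt_floor_add_one (δ * m)
      have h5 : 2 ≤ δ * m := by rwa [div_le_iff₀' hδ0] at hmδ
      change δ * m < (k m : ℝ) + 1 at h4
      linarith
    have h6 : δ / 2 * (ε / 4 / α) ≤ k m * (ε / 4 / (α * m)) := by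
      have : δ / 2 * (ε / 4 / α) = δ / 2 * m * (ε / 4 / (α * m)) := by field_simp
      rw [this]; gcongr
    linarith
  rw [Metric.tendsto_atTop']
  intro ε hε
  have h := key (min 1 (ε / 2)) (by positivity) (min_le_left _ _)
  obtain ⟨N, hN⟩ := eventually_atTop.1 h
  refine ⟨N, fun m hm => ?_⟩
  have hmpos : (0 : ℝ) < m := by exact_mod_cast (Nat.zero_le N).trans_lt hm
  have h1 := hN m hm.le
  have h2 : (r m : ℝ) / m - α = (r m - α * m) / m := by field_simp
  rw [Real.dist_eq, h2, abs_div, abs_of_pos hmpos, div_lt_iff₀ hmpos]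
  refine h1.trans_lt ?_
  have h3 : min 1 (ε / 2) ≤ ε / 2 := min_le_right _ _
  have h4 : min 1 (ε / 2) * (α * m) ≤ ε / 2 * (1 * m) := by gcongr
  nlinarith

/-! ### Typical sequences and ratios of tail counts -/

/-- The empirical tail of `x` is uniformly close to the exponential tail at all levels with a
not too small expected count. -/
def HasUniformTail (x : ℕ → ℝ) : Prop :=
  ∀ ε : ℝ, 0 < ε → ∀ᶠ n : ℕ in atTop, ∀ y : ℝ, 0 ≤ y →
    Real.log n ≤ (n * Real.exp (-y)) ^ 4 →
      |(numAbove x n y : ℝ) - n * Real.exp (-y)| ≤ ε * (n * Real.exp (-y))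

/-- The properties of a sequence of values that hold almost surely and imply the limit theorem. -/
structure IsTypical (r : ℕ → ℕ) (x : ℕ → ℝ) : Prop where
  pos : ∀ i, 0 < x i
  inj : Function.Injective x
  tail : HasUniformTail x
  growth : ∀ᶠ n : ℕ in atTop, Real.log n ≤ (numAccepted r x n : ℝ) ^ 3

theorem tendsto_log_natCast_atTop : Tendsto (fun n : ℕ => Real.log n) atTop atTop :=
  Real.tendsto_log_atTop.comp tendsto_natCast_atTop_atTop

theorem HasUniformTail.tendsto_numAbove_div_self {x : ℕ → ℝ} (hx : HasUniformTail x)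
    {ι : Type*} {l : Filter ι} {φ : ι → ℕ} {y : ι → ℝ} (hφ : Tendsto φ l atTop)
    (hy : ∀ᶠ i in l, 0 ≤ y i)
    (hlog : ∀ᶠ i in l, Real.log (φ i) ≤ (φ i * Real.exp (-y i)) ^ 4) :
    Tendsto (fun i => (numAbove x (φ i) (y i) : ℝ) / (φ i * Real.exp (-y i))) l (𝓝 1) := by
  rw [Metric.tendsto_nhds]
  intro ε hε
  filter_upwards [hφ.eventually (hx (ε / 2) (by positivity)), hy, hlog,
    hφ.eventually (eventually_ge_atTop 1)] with i h1 h2 h3 h4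
  have hpos : 0 < (φ i : ℝ) * Real.exp (-y i) := by
    have : (0 : ℝ) < φ i := by exact_mod_cast h4
    positivity
  have h5 := h1 (y i) h2 h3
  rw [Real.dist_eq, div_sub_one hpos.ne', abs_div, abs_of_pos hpos, div_lt_iff₀ hpos]
  nlinarith

/-- Here `D` is the number accepted, at the earlier or later end of a time block. The growth bound
controls `log` by a cube, and the fourth power in `HasUniformTail` beats any multiple of a cube; the
factor `2` leaves room for `φ` and `D` taken at different times. -/
theorem HasUniformTail.tendsto_numAbove_div {x : ℕ → ℝ} (hx : HasUniformTail x)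
    {ι : Type*} {l : Filter ι} {φ : ι → ℕ} {y D : ι → ℝ} {κ : ℝ} (hφ : Tendsto φ l atTop)
    (hy : ∀ᶠ i in l, 0 ≤ y i) (hD : Tendsto D l atTop)
    (hlog : ∀ᶠ i in l, Real.log (φ i) ≤ 2 * D i ^ 3) (hκ : 0 < κ)
    (h : Tendsto (fun i => φ i * Real.exp (-y i) / D i) l (𝓝 κ)) :
    Tendsto (fun i => (numAbove x (φ i) (y i) : ℝ) / D i) l (𝓝 κ) := by
  have hlog' : ∀ᶠ i in l, Real.log (φ i) ≤ (φ i * Real.exp (-y i)) ^ 4 := by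
    filter_upwards [hlog, h.eventually (lt_mem_nhds (half_lt_self hκ)),
      hD.eventually_ge_atTop (2 / (κ / 2) ^ 4), hD.eventually_gt_atTop 0] with i h1 h2 h3 h4
    rw [lt_div_iff₀ h4] at h2
    rw [div_le_iff₀ (by positivity)] at h3
    have h5 : (κ / 2 * D i) ^ 4 ≤ (φ i * Real.exp (-y i)) ^ 4 := by gcongr
    have h6 : 2 * D i ^ 3 ≤ (κ / 2 * D i) ^ 4 := by
      have : 2 * D i ^ 3 ≤ (D i * (κ / 2) ^ 4) * D i ^ 3 := by gcongr
      linarith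
    linarith
  have h1 := (hx.tendsto_numAbove_div_self hφ hy hlog').mul h
  rw [one_mul] at h1
  refine h1.congr' ?_
  filter_upwards [hφ.eventually (eventually_ge_atTop 1)] with i hi
  have : (0 : ℝ) < φ i := by exact_mod_cast hi
  exact div_mul_div_cancel₀ (by positivity)

/-- `K (c^{1/K} - 1) → log c`, as the derivative of `s ↦ c^s` at `0`. -/
theorem tendsto_one_add_mul_rpow_pow (α c : ℝ) (hc : 0 < c) :
    Tendsto (fun K : ℕ => (1 + α * (c ^ (1 / (K : ℝ)) - 1)) ^ K) atTop
      (𝓝 (Real.exp (α * Real.log c))) := by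
  apply Real.tendsto_one_add_pow_exp_of_tendsto
  have hd : HasDerivAt (fun s : ℝ => c ^ s) (Real.log c) 0 := by
    simpa using (Real.hasStrictDerivAt_const_rpow hc 0).hasDerivAt
  have h1 := hd.tendsto_slope
  have h2 : Tendsto (fun K : ℕ => 1 / (K : ℝ)) atTop (𝓝[≠] 0) := by
    rw [tendsto_nhdsWithin_iff]
    refine ⟨tendsto_one_div_atTop_nhds_zero_nat, ?_⟩
    filter_upwards [eventually_ge_atTop 1] with K hK
    have : (0 : ℝ) < K := by exact_mod_cast hK
    simp only [Set.mem_compl_iff, Set.mem_singleton_iff]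
    positivity
  refine ((h1.comp h2).const_mul α).congr' ?_
  filter_upwards [eventually_ge_atTop 1] with K hK
  have : (0 : ℝ) < K := by exact_mod_cast hK
  simp only [Function.comp_apply, slope_def_field, Real.rpow_zero, sub_zero]
  field_simp

/-! ### Asymptotics at the threshold of a typical sequence -/

namespace IsTypical

variable {r : ℕ → ℕ} {x : ℕ → ℝ} {α : ℝ}

theorem tendsto_numAccepted (h : IsTypical r x) :
    Tendsto (fun n => (numAccepted r x n : ℝ)) atTop atTop := by
  refine tendsto_atTop.2 fun C => ?_
  filter_upwards [h.growth, tendsto_log_natCast_atTop.eventually_ge_atTop (max C 0 ^ 3)]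
    with n h1 h2
  have h3 := le_of_pow_le_pow_left₀ (by norm_num) (Nat.cast_nonneg _) (h2.trans h1)
  exact (le_max_left _ _).trans h3

theorem tendsto_rank_div (h : IsTypical r x)
    (hα : Tendsto (fun m : ℕ => (r m : ℝ) / m) atTop (𝓝 α)) :
    Tendsto (fun n => (r (numAccepted r x n) : ℝ) / numAccepted r x n) atTop (𝓝 α) :=
  hα.comp (tendsto_natCast_atTop_iff.1 h.tendsto_numAccepted)

theorem tendsto_numAbove_thresholdAfter_div (h : IsTypical r x) (hr : IsRankSequence r)
    (hα : Tendsto (fun m : ℕ => (r m : ℝ) / m) atTop (𝓝 α)) :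
    Tendsto (fun n => (numAbove x n (thresholdAfter r x n) : ℝ) / numAccepted r x n) atTop
      (𝓝 α) := by
  have h1 := (h.tendsto_rank_div hα).sub (tendsto_inv_atTop_zero.comp h.tendsto_numAccepted)
  rw [sub_zero] at h1
  refine h1.congr fun n => ?_
  rw [← numAbove_thresholdAfter hr h.pos h.inj]
  push_cast
  simp only [Function.comp_apply]
  ring

/-- The uniform tail may be applied at the threshold only once the expected count there is known to
be large. Otherwise the threshold lies above the level `y` with expected count `s n = (log
n)^{1/4}`. Then `M_n` is at most a constant times `s n`, so `M_n ^ 3` is eventually less than `s n ^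
4 = log n`, against the growth bound. -/
theorem eventually_log_le (h : IsTypical r x) (hr : IsRankSequence r) (hα0 : 0 < α)
    (hα : Tendsto (fun m : ℕ => (r m : ℝ) / m) atTop (𝓝 α)) :
    ∀ᶠ n : ℕ in atTop,
      Real.log n ≤ (n * Real.exp (-thresholdAfter r x n)) ^ 4 := by
  set s : ℕ → ℝ := fun n => √√(Real.log n) with hs
  have hs_top : Tendsto s atTop atTop :=
    Real.tendsto_sqrt_atTop.comp (Real.tendsto_sqrt_atTop.comp tendsto_log_natCast_atTop)
  filter_upwards [h.tail 1 one_pos, h.growth, eventually_ge_atTop 1,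
    hs_top.eventually_ge_atTop 1, hs_top.eventually_gt_atTop ((6 / α) ^ 3),
    (h.tendsto_numAbove_thresholdAfter_div hr hα).eventually (lt_mem_nhds (half_lt_self hα0)),
    h.tendsto_numAccepted.eventually_gt_atTop 0]
    with n htail hgrow hn1 hs1 hsα hrank hM0
  by_contra! hlt
  have hn0 : (0 : ℝ) < n := by exact_mod_cast hn1
  have hs0 : 0 < s n := by linarith
  have hlog0 : 0 ≤ Real.log n := Real.log_nonneg (by exact_mod_cast hn1)
  have hs4 : s n ^ 4 = Real.log n := by
    rw [hs, show (4 : ℕ) = 2 * 2 from rfl, pow_mul, Real.sq_sqrt (Real.sqrt_nonneg _),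
      Real.sq_sqrt hlog0]
  have hsn : s n ≤ n := by
    have h1 : s n ≤ s n ^ 4 := le_self_pow₀ hs1 (by norm_num)
    rw [hs4] at h1
    exact h1.trans (Real.log_le_self hn0.le)
  set y := Real.log (n / s n) with hy
  have hy0 : 0 ≤ y := Real.log_nonneg ((one_le_div hs0).2 hsn)
  have hey : n * Real.exp (-y) = s n := by
    rw [hy, Real.exp_neg, Real.exp_log (by positivity)]; field_simp
  have h1 := htail y hy0 (by rw [hey, hs4])
  rw [hey] at h1
  have hTy : y ≤ thresholdAfter r x n := by
    have h2 : n * Real.exp (-thresholdAfter r x n) < n * Real.exp (-y) := by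
      rw [hey]
      rw [← hs4] at hlt
      exact lt_of_pow_lt_pow_left₀ 4 hs0.le hlt
    have h3 := Real.exp_lt_exp.1 (lt_of_mul_lt_mul_left h2 hn0.le)
    linarith
  have h2 : (numAbove x n (thresholdAfter r x n) : ℝ) ≤ numAbove x n y := by
    exact_mod_cast numAbove_anti_right x n hTy
  have h3 := (abs_le.1 h1).2
  rw [lt_div_iff₀ hM0] at hrank
  have h4 : (numAccepted r x n : ℝ) ≤ 6 / α * s n := by
    rw [div_mul_eq_mul_div, le_div_iff₀ hα0]; linarith
  have h5 : s n ^ 4 ≤ (6 / α * s n) ^ 3 := by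
    rw [hs4]; refine hgrow.trans ?_; gcongr
  have h6 : s n * s n ^ 3 ≤ (6 / α) ^ 3 * s n ^ 3 := by
    rw [← mul_pow]; refine le_trans (le_of_eq ?_) h5; ring
  have := le_of_mul_le_mul_right h6 (by positivity)
  linarith

/-- The expected number of values above the current threshold is asymptotic to `α M_n`. -/
theorem tendsto_mul_exp_div (h : IsTypical r x) (hr : IsRankSequence r) (hα0 : 0 < α)
    (hα : Tendsto (fun m : ℕ => (r m : ℝ) / m) atTop (𝓝 α)) :
    Tendsto (fun n : ℕ => n * Real.exp (-thresholdAfter r x n) / numAccepted r x n) atTop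
      (𝓝 α) := by
  have h1 := h.tail.tendsto_numAbove_div_self tendsto_id
    (Eventually.of_forall (thresholdAfter_nonneg hr h.pos)) (h.eventually_log_le hr hα0 hα)
  have h2 := h.tendsto_numAbove_thresholdAfter_div hr hα
  have h3 := (h1.inv₀ one_ne_zero).mul h2
  rw [inv_one, one_mul] at h3
  refine h3.congr' ?_
  filter_upwards [h2.eventually (lt_mem_nhds hα0)] with n hn
  have hne : (numAbove x n (thresholdAfter r x n) : ℝ) ≠ 0 := by
    rintro h0; rw [h0, zero_div] at hn; exact lt_irrefl _ hn
  rw [inv_div]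
  exact div_mul_div_cancel₀ hne

theorem tendsto_numAbove_add_div (h : IsTypical r x) (hr : IsRankSequence r) (hα0 : 0 < α)
    (hα : Tendsto (fun m : ℕ => (r m : ℝ) / m) atTop (𝓝 α)) {u : ℝ} (hu : 0 ≤ u) :
    Tendsto (fun n => (numAbove x n (thresholdAfter r x n + u) : ℝ) / numAccepted r x n) atTop
      (𝓝 (α * Real.exp (-u))) := by
  refine h.tail.tendsto_numAbove_div tendsto_id
    (Eventually.of_forall fun n => add_nonneg (thresholdAfter_nonneg hr h.pos n) hu)
    h.tendsto_numAccepted ?_ (by positivity) ?_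
  · filter_upwards [h.growth] with n hn
    have : (0 : ℝ) ≤ (numAccepted r x n : ℝ) ^ 3 := by positivity
    linarith
  · refine ((h.tendsto_mul_exp_div hr hα0 hα).mul_const (Real.exp (-u))).congr fun n => ?_
    rw [neg_add, Real.exp_add]; ring

/-! ### Regular variation of the number of accepted candidates -/

section Blocks

variable {ι : Type*} {l : Filter ι} {a b : ι → ℕ} {ρ : ℝ}

/-- Eventually `b ≤ (ρ + 1) a ≤ a ^ 2`. -/
theorem _root_.Hiring.eventually_log_le_of_tendsto_div (ha : Tendsto a l atTop)
    (hb : Tendsto (fun i => (b i : ℝ) / a i) l (𝓝 ρ)) :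
    ∀ᶠ i in l, Real.log (b i) ≤ 2 * Real.log (a i) := by
  have ha' : Tendsto (fun i => (a i : ℝ)) l atTop := tendsto_natCast_atTop_atTop.comp ha
  filter_upwards [hb.eventually (gt_mem_nhds (lt_add_one ρ)), ha'.eventually_ge_atTop (ρ + 1),
    ha'.eventually_ge_atTop 1] with i h1 h2 h3
  have ha0 : (0 : ℝ) < a i := by linarith
  rw [div_lt_iff₀ ha0] at h1
  have h4 : (b i : ℝ) ≤ (a i : ℝ) ^ 2 := by nlinarith
  rcases Nat.eq_zero_or_pos (b i) with hb0 | hb0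
  · rw [hb0]; simp only [Nat.cast_zero, Real.log_zero]
    have := Real.log_nonneg h3; positivity
  · have := Real.log_le_log (by exact_mod_cast hb0) h4
    rwa [Real.log_pow] at this

/-- The quantity is the upper bound for `M_b/M_a` furnished by `numAccepted_add_numAbove_le`. -/
theorem tendsto_add_sub_numAbove_div (h : IsTypical r x) (hr : IsRankSequence r) (hα0 : 0 < α)
    (hα : Tendsto (fun m : ℕ => (r m : ℝ) / m) atTop (𝓝 α)) (ha : Tendsto a l atTop)
    (hρ : 1 ≤ ρ) (hb : Tendsto (fun i => (b i : ℝ) / a i) l (𝓝 ρ)) :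
    Tendsto (fun i => 1 + (numAbove x (b i) (thresholdAfter r x (a i)) : ℝ)
        / numAccepted r x (a i) - (numAbove x (a i) (thresholdAfter r x (a i)) : ℝ)
        / numAccepted r x (a i)) l (𝓝 (1 + ρ * α - α)) := by
  have ha' : Tendsto (fun i => (a i : ℝ)) l atTop := tendsto_natCast_atTop_atTop.comp ha
  refine (tendsto_const_nhds.add ?_).sub ((h.tendsto_numAbove_thresholdAfter_div hr hα).comp ha)
  have hbtop : Tendsto b l atTop := by
    rw [← tendsto_natCast_atTop_iff (R := ℝ)]
    refine (hb.pos_mul_atTop (by linarith) ha').congr' ?_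
    filter_upwards [ha'.eventually_gt_atTop 0] with i hi
    field_simp
  refine h.tail.tendsto_numAbove_div hbtop
    (Eventually.of_forall fun i => thresholdAfter_nonneg hr h.pos _)
    (h.tendsto_numAccepted.comp ha) ?_ (by positivity) ?_
  · filter_upwards [eventually_log_le_of_tendsto_div ha hb, ha.eventually h.growth] with i h1 h2
    linarith
  · refine (hb.mul ((h.tendsto_mul_exp_div hr hα0 hα).comp ha)).congr' ?_
    filter_upwards [ha'.eventually_gt_atTop 0] with i hi
    simp only [Function.comp_apply]
    field_simp

/-- The quantity is the upper bound for `M_a/M_b` furnished by `numAccepted_add_numAbove_ge`. -/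
theorem tendsto_sub_numAbove_div (h : IsTypical r x) (hr : IsRankSequence r) (hα0 : 0 < α)
    (hα : Tendsto (fun m : ℕ => (r m : ℝ) / m) atTop (𝓝 α)) (ha : Tendsto a l atTop)
    (hab : ∀ᶠ i in l, a i ≤ b i)
    (hρ : 1 ≤ ρ) (hb : Tendsto (fun i => (b i : ℝ) / a i) l (𝓝 ρ)) :
    Tendsto (fun i => 1 + (numAbove x (a i) (thresholdAfter r x (b i)) : ℝ)
        / numAccepted r x (b i) - (numAbove x (b i) (thresholdAfter r x (b i)) : ℝ)
        / numAccepted r x (b i)) l (𝓝 (1 + ρ⁻¹ * α - α)) := by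
  have hbtop : Tendsto b l atTop := tendsto_atTop_mono' l hab ha
  have hb' : Tendsto (fun i => (b i : ℝ)) l atTop := tendsto_natCast_atTop_atTop.comp hbtop
  refine (tendsto_const_nhds.add ?_).sub
    ((h.tendsto_numAbove_thresholdAfter_div hr hα).comp hbtop)
  refine h.tail.tendsto_numAbove_div ha
    (Eventually.of_forall fun i => thresholdAfter_nonneg hr h.pos _)
    (h.tendsto_numAccepted.comp hbtop) ?_ (by positivity) ?_
  · filter_upwards [hab, hbtop.eventually h.growth, ha.eventually (eventually_ge_atTop 1)]
      with i h1 h2 h3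
    have h4 : Real.log (a i) ≤ Real.log (b i) :=
      Real.log_le_log (by exact_mod_cast h3) (by exact_mod_cast h1)
    have : (0 : ℝ) ≤ (numAccepted r x (b i) : ℝ) ^ 3 := by positivity
    linarith
  · refine ((hb.inv₀ (by positivity)).mul
      ((h.tendsto_mul_exp_div hr hα0 hα).comp hbtop)).congr' ?_
    filter_upwards [hb'.eventually_gt_atTop 0] with i hi
    simp only [Function.comp_apply]
    field_simp

theorem eventually_numAccepted_le (h : IsTypical r x) (hr : IsRankSequence r) (hα0 : 0 < α)
    (hα : Tendsto (fun m : ℕ => (r m : ℝ) / m) atTop (𝓝 α)) (ha : Tendsto a l atTop)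
    (hab : ∀ᶠ i in l, a i ≤ b i)
    (hρ : 1 ≤ ρ) (hb : Tendsto (fun i => (b i : ℝ) / a i) l (𝓝 ρ)) {ε : ℝ} (hε : 0 < ε) :
    ∀ᶠ i in l,
      (numAccepted r x (b i) : ℝ) ≤ (1 + α * (ρ - 1) + ε) * numAccepted r x (a i) ∧
      (numAccepted r x (a i) : ℝ) ≤ (1 + α * (ρ⁻¹ - 1) + ε) * numAccepted r x (b i) := by
  have hbtop : Tendsto b l atTop := tendsto_atTop_mono' l hab ha
  have e1 : 1 + ρ * α - α < 1 + α * (ρ - 1) + ε := by linarith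
  have e2 : 1 + ρ⁻¹ * α - α < 1 + α * (ρ⁻¹ - 1) + ε := by linarith
  filter_upwards [hab, ha.eventually (h.tendsto_numAccepted.eventually_gt_atTop 0),
    hbtop.eventually (h.tendsto_numAccepted.eventually_gt_atTop 0),
    (h.tendsto_add_sub_numAbove_div hr hα0 hα ha hρ hb).eventually (gt_mem_nhds e1),
    (h.tendsto_sub_numAbove_div hr hα0 hα ha hab hρ hb).eventually (gt_mem_nhds e2)]
    with i h1 h2 h3 h4 h5
  constructor
  · have h6 : (numAccepted r x (b i) : ℝ) + numAbove x (a i) (thresholdAfter r x (a i)) ≤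
      numAccepted r x (a i) + numAbove x (b i) (thresholdAfter r x (a i)) := by
      exact_mod_cast numAccepted_add_numAbove_le hr h.pos h1
    have h7 := mul_le_mul_of_nonneg_right h4.le h2.le
    have h8 : (1 + (numAbove x (b i) (thresholdAfter r x (a i)) : ℝ) / numAccepted r x (a i)
      - (numAbove x (a i) (thresholdAfter r x (a i)) : ℝ) / numAccepted r x (a i))
        * numAccepted r x (a i) = numAccepted r x (a i)
        + numAbove x (b i) (thresholdAfter r x (a i))
        - numAbove x (a i) (thresholdAfter r x (a i)) := by field_simp
    linarith
  · have h6 : (numAccepted r x (a i) : ℝ) + numAbove x (b i) (thresholdAfter r x (b i)) ≤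
      numAccepted r x (b i) + numAbove x (a i) (thresholdAfter r x (b i)) := by
      exact_mod_cast numAccepted_add_numAbove_ge hr h.pos h1
    have h7 := mul_le_mul_of_nonneg_right h5.le h3.le
    have h8 : (1 + (numAbove x (a i) (thresholdAfter r x (b i)) : ℝ) / numAccepted r x (b i)
      - (numAbove x (b i) (thresholdAfter r x (b i)) : ℝ) / numAccepted r x (b i))
        * numAccepted r x (b i) = numAccepted r x (b i)
        + numAbove x (a i) (thresholdAfter r x (b i))
        - numAbove x (b i) (thresholdAfter r x (b i)) := by field_simp
    linarith

theorem eventually_numAccepted_le_pow (h : IsTypical r x) (hr : IsRankSequence r) (hα0 : 0 < α)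
    (hα1 : α < 1) (hα : Tendsto (fun m : ℕ => (r m : ℝ) / m) atTop (𝓝 α))
    (hρ : 1 ≤ ρ) {ε : ℝ} (hε : 0 < ε) (K : ℕ) (a b : ι → ℕ) (ha : Tendsto a l atTop)
    (hab : ∀ᶠ i in l, a i ≤ b i)
    (hb : Tendsto (fun i => (b i : ℝ) / a i) l (𝓝 (ρ ^ (K + 1)))) :
    ∀ᶠ i in l,
      (numAccepted r x (b i) : ℝ) ≤ (1 + α * (ρ - 1) + ε) ^ (K + 1) * numAccepted r x (a i) ∧
      (numAccepted r x (a i) : ℝ) ≤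
        (1 + α * (ρ⁻¹ - 1) + ε) ^ (K + 1) * numAccepted r x (b i) := by
  have hρ0 : 0 < ρ := by linarith
  have hA : 0 ≤ 1 + α * (ρ - 1) + ε := by
    have := mul_nonneg hα0.le (sub_nonneg.2 hρ); linarith
  have hB : 0 ≤ 1 + α * (ρ⁻¹ - 1) + ε := by
    have := mul_pos hα0 (inv_pos.2 hρ0); linarith
  induction K generalizing b with
  | zero =>
    simp only [zero_add, pow_one] at hb ⊢
    exact h.eventually_numAccepted_le hr hα0 hα ha hab hρ hb hε
  | succ K ih =>
    have ha' : Tendsto (fun i => (a i : ℝ)) l atTop := tendsto_natCast_atTop_atTop.comp ha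
    -- Intermediate time that peels off the last factor `ρ`. The maximum makes `a ≤ c` hold
    -- everywhere; it does not change the limit of `c/a`, since that limit is at least `1`.
    set c : ι → ℕ := fun i => max (a i) ⌊(b i : ℝ) / ρ⌋₊ with hc
    have hac : ∀ i, a i ≤ c i := fun i => le_max_left _ _
    have hcb : ∀ᶠ i in l, c i ≤ b i := by
      filter_upwards [hab] with i hi
      refine max_le hi ?_
      exact Nat.floor_le_of_le (div_le_self (Nat.cast_nonneg _) hρ)
    have hbtop : Tendsto (fun i => (b i : ℝ) / ρ) l atTop :=
      (tendsto_natCast_atTop_atTop.comp (tendsto_atTop_mono' l hab ha)).atTop_div_const hρ0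
    have hca : Tendsto (fun i => (c i : ℝ) / a i) l (𝓝 (ρ ^ (K + 1))) := by
      have h1 : Tendsto (fun i => (⌊(b i : ℝ) / ρ⌋₊ : ℝ) / a i) l (𝓝 (ρ ^ (K + 1))) := by
        have h2 := ((tendsto_nat_floor_div_atTop (R := ℝ)).comp hbtop).mul (hb.div_const ρ)
        have e : 1 * (ρ ^ (K + 1 + 1) / ρ) = ρ ^ (K + 1) := by
          rw [pow_succ ρ (K + 1)]; field_simp
        rw [e] at h2
        refine h2.congr' ?_
        filter_upwards [hbtop.eventually_gt_atTop 0] with i hi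
        simp only [Function.comp_apply]
        rw [div_right_comm (b i : ℝ)]
        exact div_mul_div_cancel₀ hi.ne'
      have h3 := (tendsto_const_nhds (x := (1 : ℝ))).max h1
      rw [max_eq_right (one_le_pow₀ hρ)] at h3
      refine h3.congr' ?_
      filter_upwards [ha'.eventually_gt_atTop 0] with i hi
      simp only [hc, Nat.cast_max]
      rw [← max_div_div_right hi.le, div_self hi.ne']
    have hctop : Tendsto c l atTop := tendsto_atTop_mono hac ha
    have hbc : Tendsto (fun i => (b i : ℝ) / c i) l (𝓝 ρ) := by
      have h2 := hb.div hca (by positivity)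
      have e : ρ ^ (K + 1 + 1) / ρ ^ (K + 1) = ρ := by
        rw [pow_succ ρ (K + 1)]; field_simp
      rw [e] at h2
      refine h2.congr' ?_
      filter_upwards [ha'.eventually_gt_atTop 0] with i hi
      simp only [Pi.div_apply]
      exact div_div_div_cancel_right₀ hi.ne' _ _
    filter_upwards [ih c (Eventually.of_forall hac) hca,
      h.eventually_numAccepted_le hr hα0 hα hctop hcb hρ hbc hε] with i h1 h2
    constructor
    · calc (numAccepted r x (b i) : ℝ) ≤ _ := h2.1
        _ ≤ (1 + α * (ρ - 1) + ε) * ((1 + α * (ρ - 1) + ε) ^ (K + 1) * numAccepted r x (a i)) := by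
          gcongr; exact h1.1
        _ = _ := by ring
    · calc (numAccepted r x (a i) : ℝ) ≤ _ := h1.2
        _ ≤ (1 + α * (ρ⁻¹ - 1) + ε) ^ (K + 1)
            * ((1 + α * (ρ⁻¹ - 1) + ε) * numAccepted r x (b i)) := by
          gcongr; exact h2.2
        _ = _ := by ring

end Blocks

end IsTypical

/-- The number of factors is fixed first; then continuity in `ε` absorbs the error made in each
factor. Used for both `c` and `c⁻¹`. -/
theorem exists_pow_add_lt {α c q : ℝ} (hc : 0 < c) (hq : Real.exp (α * Real.log c) < q) :
    ∃ K : ℕ, ∃ δ : ℝ, 0 < δ ∧ ∀ ε : ℝ, 0 < ε → ε < δ →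
      (1 + α * (c ^ (1 / ((K + 1 : ℕ) : ℝ)) - 1) + ε) ^ (K + 1) < q := by
  have h1 := (tendsto_one_add_mul_rpow_pow α c hc).eventually (gt_mem_nhds hq)
  obtain ⟨K, hK, hK1⟩ := (h1.and (eventually_ge_atTop 1)).exists
  obtain ⟨K, rfl⟩ : ∃ k, K = k + 1 := ⟨K - 1, by omega⟩
  have hcont : Continuous fun ε : ℝ =>
      (1 + α * (c ^ (1 / ((K + 1 : ℕ) : ℝ)) - 1) + ε) ^ (K + 1) := by fun_prop
  have h2 := (hcont.tendsto 0).eventually_lt_const (u := q) (by simpa using hK)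
  obtain ⟨δ, hδ, h3⟩ := Metric.eventually_nhds_iff.1 h2
  refine ⟨K, δ, hδ, fun ε hε hεδ => h3 ?_⟩
  rwa [Real.dist_eq, sub_zero, abs_of_pos hε]

namespace IsTypical

variable {r : ℕ → ℕ} {x : ℕ → ℝ} {α : ℝ}
variable {ι : Type*} {l : Filter ι} {a b : ι → ℕ}

/-- The number of accepted candidates is regularly varying with index `α`. -/
theorem tendsto_numAccepted_div (h : IsTypical r x) (hr : IsRankSequence r) (hα0 : 0 < α)
    (hα1 : α < 1) (hα : Tendsto (fun m : ℕ => (r m : ℝ) / m) atTop (𝓝 α))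
    (ha : Tendsto a l atTop) (hab : ∀ᶠ i in l, a i ≤ b i) {c : ℝ} (hc : 1 ≤ c)
    (hb : Tendsto (fun i => (b i : ℝ) / a i) l (𝓝 c)) :
    Tendsto (fun i => (numAccepted r x (a i) : ℝ) / numAccepted r x (b i)) l
      (𝓝 (Real.exp (-(α * Real.log c)))) := by
  have hc0 : 0 < c := by linarith
  have hbtop : Tendsto b l atTop := tendsto_atTop_mono' l hab ha
  have hMb := hbtop.eventually (h.tendsto_numAccepted.eventually_gt_atTop 0)
  have hroot : ∀ K : ℕ, 1 ≤ c ^ (1 / ((K + 1 : ℕ) : ℝ)) ∧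
      (c ^ (1 / ((K + 1 : ℕ) : ℝ))) ^ (K + 1) = c := by
    intro K
    refine ⟨Real.one_le_rpow hc (by positivity), ?_⟩
    rw [← Real.rpow_natCast, ← Real.rpow_mul hc0.le, one_div_mul_cancel (by positivity),
      Real.rpow_one]
  rw [tendsto_order]
  constructor
  · intro q hq
    -- `q` may be nonpositive; a positive `q'` above it can be inverted to bound `M_b/M_a`.
    obtain ⟨q', hq1, hq2⟩ := exists_between (max_lt hq (Real.exp_pos (-(α * Real.log c))))
    have hq0 : 0 < q' := (le_max_right _ _).trans_lt hq1
    have hlt : Real.exp (α * Real.log c) < 1 / q' := by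
      rw [lt_one_div (Real.exp_pos _) hq0, one_div, ← Real.exp_neg]; exact hq2
    obtain ⟨K, δ, hδ, hK⟩ := exists_pow_add_lt hc0 hlt
    have hb' := hb
    rw [← (hroot K).2] at hb'
    filter_upwards [hMb, h.eventually_numAccepted_le_pow hr hα0 hα1 hα (hroot K).1
      (half_pos hδ) K a b ha hab hb'] with i h1 h2
    rw [lt_div_iff₀ h1]
    have h3 := h2.1.trans (mul_le_mul_of_nonneg_right (hK _ (half_pos hδ) (half_lt_self hδ)).le
      (Nat.cast_nonneg _))
    rw [one_div_mul_eq_div, le_div_iff₀ hq0] at h3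
    have h4 : q * numAccepted r x (b i) < q' * numAccepted r x (b i) :=
      mul_lt_mul_of_pos_right ((le_max_left _ _).trans_lt hq1) h1
    linarith
  · intro q hq
    have hlt : Real.exp (α * Real.log c⁻¹) < q := by
      rwa [Real.log_inv, mul_neg]
    obtain ⟨K, δ, hδ, hK⟩ := exists_pow_add_lt (inv_pos.2 hc0) hlt
    have hb' := hb
    rw [← (hroot K).2] at hb'
    filter_upwards [hMb, h.eventually_numAccepted_le_pow hr hα0 hα1 hα (hroot K).1
      (half_pos hδ) K a b ha hab hb'] with i h1 h2
    rw [div_lt_iff₀ h1]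
    have h3 := hK _ (half_pos hδ) (half_lt_self hδ)
    rw [Real.inv_rpow hc0.le] at h3
    exact h2.2.trans_lt (mul_lt_mul_of_pos_right h3 h1)

/-! ### Limits of the accepted fractions -/

/-- By `n e^{-T_n} ~ α M_n` at both ends, `e^{T_b - T_a} ~ (b/a)(M_a/M_b) → c · c^{-α}`. -/
theorem tendsto_sub_thresholdAfter (h : IsTypical r x) (hr : IsRankSequence r) (hα0 : 0 < α)
    (hα1 : α < 1) (hα : Tendsto (fun m : ℕ => (r m : ℝ) / m) atTop (𝓝 α))
    (ha : Tendsto a l atTop) (hab : ∀ᶠ i in l, a i ≤ b i) {c : ℝ} (hc : 1 ≤ c)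
    (hb : Tendsto (fun i => (b i : ℝ) / a i) l (𝓝 c)) :
    Tendsto (fun i => thresholdAfter r x (b i) - thresholdAfter r x (a i)) l
      (𝓝 ((1 - α) * Real.log c)) := by
  have hc0 : 0 < c := by linarith
  have hbtop : Tendsto b l atTop := tendsto_atTop_mono' l hab ha
  have hk := h.tendsto_mul_exp_div hr hα0 hα
  have h1 := (((hk.comp ha).mul (h.tendsto_numAccepted_div hr hα0 hα1 hα ha hab hc hb)).mul
    ((hk.comp hbtop).inv₀ hα0.ne')).mul hb
  have e : α * Real.exp (-(α * Real.log c)) * α⁻¹ * c = Real.exp ((1 - α) * Real.log c) := by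
    rw [sub_mul, one_mul, sub_eq_add_neg, Real.exp_add, Real.exp_log hc0]
    field_simp
  rw [e] at h1
  have h2 : Tendsto (fun i => Real.exp (thresholdAfter r x (b i) - thresholdAfter r x (a i))) l
      (𝓝 (Real.exp ((1 - α) * Real.log c))) := by
    refine h1.congr' ?_
    filter_upwards [ha.eventually (h.tendsto_numAccepted.eventually_gt_atTop 0),
      hbtop.eventually (h.tendsto_numAccepted.eventually_gt_atTop 0),
      ha.eventually (eventually_ge_atTop 1), hbtop.eventually (eventually_ge_atTop 1)]
      with i h3 h4 h5 h6
    have h5' : (0 : ℝ) < a i := by exact_mod_cast h5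
    have h6' : (0 : ℝ) < b i := by exact_mod_cast h6
    simp only [Function.comp_apply, Real.exp_sub, Real.exp_neg]
    field_simp
  have h3 := ((Real.continuousAt_log (Real.exp_pos ((1 - α) * Real.log c)).ne').tendsto).comp h2
  rw [Real.log_exp] at h3
  exact h3.congr fun i => Real.log_exp _

theorem tendsto_numAcceptedLE_add_div_of_nonneg (h : IsTypical r x) (hr : IsRankSequence r)
    (hα0 : 0 < α) (hα : Tendsto (fun m : ℕ => (r m : ℝ) / m) atTop (𝓝 α)) {u : ℝ} (hu : 0 ≤ u) :
    Tendsto (fun n => (numAcceptedLE r x n (thresholdAfter r x n + u) : ℝ)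
      / numAccepted r x n) atTop (𝓝 (1 - α * Real.exp (-u))) := by
  refine ((h.tendsto_numAbove_add_div hr hα0 hα hu).const_sub 1).congr' ?_
  filter_upwards [h.tendsto_numAccepted.eventually_gt_atTop 0] with n hn
  have h1 := numAcceptedLE_add_numAbove hr h.pos
    (le_add_of_nonneg_right hu : thresholdAfter r x n ≤ thresholdAfter r x n + u)
  have h2 : (numAcceptedLE r x n (thresholdAfter r x n + u) : ℝ)
    + numAbove x n (thresholdAfter r x n + u) = numAccepted r x n := by exact_mod_cast h1
  rw [eq_div_iff hn.ne', sub_mul, div_mul_cancel₀ _ hn.ne']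
  linarith

/-- The numerator is frozen from time `a` on, where it is about `(1 - α) M_a`. -/
theorem tendsto_numAcceptedLE_div (h : IsTypical r x) (hr : IsRankSequence r) (hα0 : 0 < α)
    (hα1 : α < 1) (hα : Tendsto (fun m : ℕ => (r m : ℝ) / m) atTop (𝓝 α))
    (ha : Tendsto a l atTop) (hab : ∀ᶠ i in l, a i ≤ b i) {c : ℝ} (hc : 1 ≤ c)
    (hb : Tendsto (fun i => (b i : ℝ) / a i) l (𝓝 c)) :
    Tendsto (fun i => (numAcceptedLE r x (b i) (thresholdAfter r x (a i)) : ℝ)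
      / numAccepted r x (b i)) l (𝓝 ((1 - α) * Real.exp (-(α * Real.log c)))) := by
  have h1 := h.tendsto_numAcceptedLE_add_div_of_nonneg hr hα0 hα (le_refl 0)
  rw [neg_zero, Real.exp_zero, mul_one] at h1
  have h2 := (h1.comp ha).mul (h.tendsto_numAccepted_div hr hα0 hα1 hα ha hab hc hb)
  refine h2.congr' ?_
  filter_upwards [ha.eventually (h.tendsto_numAccepted.eventually_gt_atTop 0), hab] with i h3 h4
  rw [numAcceptedLE_thresholdAfter hr h.pos h4]
  simp only [Function.comp_apply, add_zero]
  exact div_mul_div_cancel₀ h3.ne'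

theorem tendsto_floor_mul {v : ℝ} (hv0 : 0 < v) :
    Tendsto (fun n : ℕ => ⌊v * n⌋₊) atTop atTop ∧
      Tendsto (fun n : ℕ => (n : ℝ) / (⌊v * n⌋₊ : ℝ)) atTop (𝓝 v⁻¹) := by
  have hv : Tendsto (fun n : ℕ => v * n) atTop atTop :=
    tendsto_natCast_atTop_atTop.const_mul_atTop hv0
  refine ⟨tendsto_nat_floor_atTop.comp hv, ?_⟩
  have h1 := (tendsto_nat_floor_mul_div_atTop (R := ℝ) hv0.le).comp tendsto_natCast_atTop_atTop
  refine (h1.inv₀ hv0.ne').congr fun n => ?_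
  simp

/-- The two-sided comparison of levels below the threshold with earlier thresholds. -/
theorem eventually_numAcceptedLE_add_div (h : IsTypical r x) (hr : IsRankSequence r)
    (hα0 : 0 < α) (hα1 : α < 1) (hα : Tendsto (fun m : ℕ => (r m : ℝ) / m) atTop (𝓝 α))
    {s : ℝ} (hs : 0 < s) {u : ℝ} :
    (u < -((1 - α) * s) → ∀ q, (1 - α) * Real.exp (-(α * s)) < q → ∀ᶠ n in atTop,
      (numAcceptedLE r x n (thresholdAfter r x n + u) : ℝ) / numAccepted r x n < q) ∧
    (-((1 - α) * s) < u → ∀ q, q < (1 - α) * Real.exp (-(α * s)) → ∀ᶠ n in atTop,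
      q < (numAcceptedLE r x n (thresholdAfter r x n + u) : ℝ) / numAccepted r x n) := by
  have hfl := tendsto_floor_mul (Real.exp_pos (-s))
  rw [← Real.exp_neg, neg_neg] at hfl
  set a : ℕ → ℕ := fun n => ⌊Real.exp (-s) * n⌋₊ with ha
  have hab : ∀ᶠ n in atTop, a n ≤ n := by
    refine Eventually.of_forall fun n => Nat.floor_le_of_le ?_
    exact mul_le_of_le_one_left (Nat.cast_nonneg _) (Real.exp_le_one_iff.2 (by linarith))
  have hc : 1 ≤ Real.exp s := Real.one_le_exp hs.le
  have h1 := h.tendsto_sub_thresholdAfter hr hα0 hα1 hα hfl.1 hab hc hfl.2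
  have h2 := h.tendsto_numAcceptedLE_div hr hα0 hα1 hα hfl.1 hab hc hfl.2
  rw [Real.log_exp] at h1 h2
  constructor
  · intro hu q hq
    filter_upwards [h1.eventually (gt_mem_nhds (by linarith : (1 - α) * s < -u)),
      h2.eventually (gt_mem_nhds hq)] with n h3 h4
    refine lt_of_le_of_lt ?_ h4
    gcongr
    exact numAcceptedLE_mono r x n (by linarith)
  · intro hu q hq
    filter_upwards [h1.eventually (lt_mem_nhds (by linarith : -u < (1 - α) * s)),
      h2.eventually (lt_mem_nhds hq)] with n h3 h4
    refine lt_of_lt_of_le h4 ?_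
    gcongr
    exact numAcceptedLE_mono r x n (by linarith)

/-- The level `T_n + u` is only asymptotically the threshold at time `e^{-s₀} n`, so it is squeezed
between thresholds with `s` slightly larger and slightly smaller than `s₀`; continuity in `s` closes
the gap. -/
theorem tendsto_numAcceptedLE_add_div_of_neg (h : IsTypical r x) (hr : IsRankSequence r)
    (hα0 : 0 < α) (hα1 : α < 1) (hα : Tendsto (fun m : ℕ => (r m : ℝ) / m) atTop (𝓝 α))
    {u : ℝ} (hu : u < 0) :
    Tendsto (fun n => (numAcceptedLE r x n (thresholdAfter r x n + u) : ℝ)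
      / numAccepted r x n) atTop (𝓝 ((1 - α) * Real.exp (α * u / (1 - α)))) := by
  have hα' : 0 < 1 - α := by linarith
  set s₀ := -u / (1 - α) with hs₀
  have hs₀pos : 0 < s₀ := div_pos (by linarith) hα'
  have hmul : (1 - α) * s₀ = -u := by rw [hs₀]; field_simp
  have hcont : Tendsto (fun s : ℝ => (1 - α) * Real.exp (-(α * s))) (𝓝 s₀)
      (𝓝 ((1 - α) * Real.exp (α * u / (1 - α)))) := by
    have : Continuous (fun s : ℝ => (1 - α) * Real.exp (-(α * s))) := by fun_prop
    have h1 := this.tendsto s₀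
    have e : -(α * s₀) = α * u / (1 - α) := by rw [hs₀]; ring
    simpa only [e] using h1
  rw [tendsto_order]
  constructor
  · intro q hq
    have h1 : ∀ᶠ s in 𝓝[>] s₀, q < (1 - α) * Real.exp (-(α * s)) :=
      (hcont.mono_left nhdsWithin_le_nhds).eventually (lt_mem_nhds hq)
    obtain ⟨s, hsq, hs⟩ := (h1.and self_mem_nhdsWithin).exists
    have hs' : s₀ < s := hs
    refine (h.eventually_numAcceptedLE_add_div hr hα0 hα1 hα (hs₀pos.trans hs')).2 ?_ q hsq
    have := mul_lt_mul_of_pos_left hs' hα'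
    linarith
  · intro q hq
    have h1 : ∀ᶠ s in 𝓝[<] s₀, (1 - α) * Real.exp (-(α * s)) < q :=
      (hcont.mono_left nhdsWithin_le_nhds).eventually (gt_mem_nhds hq)
    have h2 : ∀ᶠ s in 𝓝[<] s₀, 0 < s :=
      nhdsWithin_le_nhds (lt_mem_nhds hs₀pos)
    obtain ⟨s, ⟨hsq, hspos⟩, hs⟩ := ((h1.and h2).and self_mem_nhdsWithin).exists
    have hs' : s < s₀ := hs
    refine (h.eventually_numAcceptedLE_add_div hr hα0 hα1 hα hspos).1 ?_ q hsq
    have := mul_lt_mul_of_pos_left hs' hα'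
    linarith

theorem tendsto_numAcceptedLE_add_div (h : IsTypical r x) (hr : IsRankSequence r)
    (hα0 : 0 < α) (hα1 : α < 1) (hα : Tendsto (fun m : ℕ => (r m : ℝ) / m) atTop (𝓝 α))
    (u : ℝ) :
    Tendsto (fun n => (numAcceptedLE r x n (thresholdAfter r x n + u) : ℝ)
      / numAccepted r x n) atTop (𝓝 (limitCDF α u)) := by
  rcases lt_trichotomy u 0 with hu | rfl | hu
  · rw [limitCDF, if_pos hu.le]
    exact h.tendsto_numAcceptedLE_add_div_of_neg hr hα0 hα1 hα hu
  · have := h.tendsto_numAcceptedLE_add_div_of_nonneg hr hα0 hα (le_refl 0)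
    simpa [limitCDF] using this
  · rw [limitCDF, if_neg (not_le.2 hu)]
    exact h.tendsto_numAcceptedLE_add_div_of_nonneg hr hα0 hα hu.le

/-- `currentThreshold` lags one candidate behind; that candidate changes numerator and denominator
by at most one, which is negligible as `M_n → ∞`. -/
theorem tendsto_empirical_cdf (h : IsTypical r x) (hr : IsRankSequence r)
    (hα0 : 0 < α) (hα1 : α < 1) (hα : Tendsto (fun m : ℕ => (r m : ℝ) / m) atTop (𝓝 α))
    (u : ℝ) :
    Tendsto (fun n => (numAcceptedLE r x n (currentThreshold r x n + u) : ℝ)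
      / numAccepted r x n) atTop (𝓝 (limitCDF α u)) := by
  rw [← tendsto_add_atTop_iff_nat 1]
  have hM := h.tendsto_numAccepted
  have hinv : Tendsto (fun n => 1 / (numAccepted r x n : ℝ)) atTop (𝓝 0) := by
    exact (tendsto_inv_atTop_zero.comp hM).congr fun n => by simp
  have hlim := h.tendsto_numAcceptedLE_add_div hr hα0 hα1 hα u
  have h1 : Tendsto (fun n => (numAcceptedLE r x (n + 1) (thresholdAfter r x n + u) : ℝ)
      / numAccepted r x n) atTop (𝓝 (limitCDF α u)) := by
    have hup := hlim.add hinv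
    rw [add_zero] at hup
    refine tendsto_of_tendsto_of_tendsto_of_le_of_le hlim hup (fun n => ?_) (fun n => ?_)
    · simp only
      gcongr
      exact numAcceptedLE_mono_left r x _ (Nat.le_succ n)
    · simp only [← add_div]
      gcongr
      exact_mod_cast numAcceptedLE_succ_le r x n _
  have h2 : Tendsto (fun n => (numAccepted r x (n + 1) : ℝ) / numAccepted r x n) atTop
      (𝓝 1) := by
    have hup := hinv.const_add 1
    rw [add_zero] at hup
    refine tendsto_of_tendsto_of_tendsto_of_le_of_le' tendsto_const_nhds hup ?_ ?_
    · filter_upwards [hM.eventually_gt_atTop 0] with n hn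
      rw [one_le_div hn]
      exact_mod_cast numAccepted_mono r x (Nat.le_succ n)
    · filter_upwards [hM.eventually_gt_atTop 0] with n hn
      rw [div_le_iff₀ hn, add_mul, one_div_mul_cancel hn.ne', one_mul]
      exact_mod_cast numAccepted_succ_le r x n
  have h3 := h1.div h2 one_ne_zero
  rw [div_one] at h3
  refine h3.congr' ?_
  filter_upwards [hM.eventually_gt_atTop 0] with n hn
  simp only [Pi.div_apply]
  exact div_div_div_cancel_right₀ hn.ne' _ _

end IsTypical

/-! ### Chernoff bounds and Borel–Cantelli -/

section Probability

variable {Ω : Type*} [MeasurableSpace Ω] {P : Measure Ω}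
  {X : ℕ → Ω → ℝ}

theorem measureReal_lt_of_map_eq_expMeasure {Y : Ω → ℝ} (hY : Measurable Y)
    (hexp : P.map Y = expMeasure 1) {y : ℝ} (hy : 0 ≤ y) :
    P.real {ω | y < Y ω} = Real.exp (-y) := by
  have := isProbabilityMeasure_expMeasure one_pos
  have h1 : P.real {ω | y < Y ω} = (expMeasure 1).real (Set.Iic y)ᶜ := by
    rw [← hexp, map_measureReal_apply hY measurableSet_Iic.compl]
    congr 1; ext ω; simp
  rw [h1, probReal_compl_eq_one_sub measurableSet_Iic, ← cdf_eq_real, cdf_expMeasure_eq one_pos,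
    if_pos hy, one_mul, sub_sub_cancel]

variable [IsProbabilityMeasure P]

theorem numAbove_eq_sum (x : ℕ → ℝ) (n : ℕ) (y : ℝ) :
    (numAbove x n y : ℝ) = ∑ i ∈ Finset.range n, (Set.Ioi y).indicator (fun _ => (1 : ℝ)) (x i) := by
  rw [numAbove, Finset.card_filter]
  push_cast
  exact Finset.sum_congr rfl fun i _ => by simp [Set.indicator_apply]

theorem measurable_indicator_Ioi (y : ℝ) :
    Measurable ((Set.Ioi y).indicator (fun _ => (1 : ℝ))) :=
  measurable_const.indicator measurableSet_Ioi

/-- The count is binomial with success probability `p = e^{-y}`, and `1 + p(e^t - 1) ≤ exp(p(e^t -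
1))` compares it with a Poisson variable. -/
theorem mgf_numAbove_le (hX : ∀ i, Measurable (X i)) (hindep : iIndepFun X P)
    (hexp : ∀ i, P.map (X i) = expMeasure 1) (n : ℕ) {y : ℝ} (hy : 0 ≤ y) (t : ℝ) :
    mgf (fun ω => (numAbove (fun i => X i ω) n y : ℝ)) P t ≤
      Real.exp (n * Real.exp (-y) * (Real.exp t - 1)) := by
  set g := (Set.Ioi y).indicator (fun _ => (1 : ℝ)) with hg
  have h1 : (fun ω => (numAbove (fun i => X i ω) n y : ℝ)) =
      ∑ i ∈ Finset.range n, g ∘ X i := by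
    ext ω; rw [numAbove_eq_sum, Finset.sum_apply]; rfl
  have hind : iIndepFun (fun i => g ∘ X i) P :=
    hindep.comp (fun _ => g) fun _ => measurable_indicator_Ioi y
  rw [h1, hind.mgf_sum (fun i => (measurable_indicator_Ioi y).comp (hX i))]
  have h2 : ∀ i, mgf (g ∘ X i) P t ≤ Real.exp (Real.exp (-y) * (Real.exp t - 1)) := by
    intro i
    have hm : MeasurableSet {ω | y < X i ω} := measurableSet_lt measurable_const (hX i)
    have h3 : (fun ω => Real.exp (t * (g ∘ X i) ω)) =
        fun ω => 1 + {ω | y < X i ω}.indicator (fun _ => Real.exp t - 1) ω := by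
      ext ω
      by_cases h : y < X i ω <;> simp [hg, h]
    rw [mgf, h3, integral_add (integrable_const _) ((integrable_const _).indicator hm),
      integral_indicator_const _ hm, measureReal_lt_of_map_eq_expMeasure (hX i) (hexp i) hy]
    simp only [integral_const, probReal_univ, smul_eq_mul, mul_one]
    linarith [Real.add_one_le_exp (Real.exp (-y) * (Real.exp t - 1))]
  calc ∏ i ∈ Finset.range n, mgf (g ∘ X i) P t
      ≤ ∏ _i ∈ Finset.range n, Real.exp (Real.exp (-y) * (Real.exp t - 1)) :=
        Finset.prod_le_prod (fun i _ => mgf_nonneg) fun i _ => h2 i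
    _ = Real.exp (n * Real.exp (-y) * (Real.exp t - 1)) := by
        rw [Finset.prod_const, Finset.card_range, ← Real.exp_nat_mul, mul_assoc]

theorem measurable_numAbove (hX : ∀ i, Measurable (X i)) (n : ℕ) (y : ℝ) :
    Measurable fun ω => (numAbove (fun i => X i ω) n y : ℝ) := by
  simp only [numAbove_eq_sum]
  exact Finset.measurable_sum _ fun i _ => (measurable_indicator_Ioi y).comp (hX i)

theorem integrable_exp_mul_numAbove (hX : ∀ i, Measurable (X i)) (n : ℕ) (y t : ℝ) :
    Integrable (fun ω => Real.exp (t * (numAbove (fun i => X i ω) n y : ℝ))) P := by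
  refine Integrable.of_bound ((measurable_numAbove hX n y).const_mul t).exp.aestronglyMeasurable
    (Real.exp (|t| * n)) (Eventually.of_forall fun ω => ?_)
  rw [Real.norm_eq_abs, Real.abs_exp]
  refine Real.exp_le_exp.2 ((le_abs_self _).trans ?_)
  rw [abs_mul, Nat.abs_cast]
  gcongr
  exact (Finset.card_filter_le _ _).trans_eq (Finset.card_range n)

/-- Chernoff at `t = δ/2`, with `e^t - 1 ≤ t + t²`. Only a bound `k` on the mean is assumed, because
grid times are rounded to integers. -/
theorem measure_numAbove_ge_le (hX : ∀ i, Measurable (X i)) (hindep : iIndepFun X P)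
    (hexp : ∀ i, P.map (X i) = expMeasure 1) {n : ℕ} {y k δ : ℝ} (hy : 0 ≤ y) (hδ : 0 < δ)
    (hδ1 : δ ≤ 1) (hk : n * Real.exp (-y) ≤ k) :
    P.real {ω | (1 + δ) * k ≤ numAbove (fun i => X i ω) n y} ≤
      Real.exp (-(δ ^ 2 / 4 * k)) := by
  have hk0 : 0 ≤ k := le_trans (by positivity) hk
  refine (measure_ge_le_exp_mul_mgf (t := δ / 2) _ (by positivity)
    (integrable_exp_mul_numAbove hX n y _)).trans ?_
  have h1 := mgf_numAbove_le hX hindep hexp n hy (δ / 2)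
  have h2 : Real.exp (δ / 2) - 1 ≤ δ / 2 + (δ / 2) ^ 2 := by
    have := (abs_le.1 (Real.abs_exp_sub_one_sub_id_le (x := δ / 2)
      (by rw [abs_of_pos (by positivity)]; linarith))).2
    linarith
  have h0 : 0 ≤ Real.exp (δ / 2) - 1 := by linarith [Real.add_one_le_exp (δ / 2)]
  calc _ ≤ Real.exp (-(δ / 2) * ((1 + δ) * k)) *
        Real.exp (n * Real.exp (-y) * (Real.exp (δ / 2) - 1)) := by gcongr
    _ = Real.exp (-(δ / 2) * ((1 + δ) * k) + n * Real.exp (-y) * (Real.exp (δ / 2) - 1)) :=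
        (Real.exp_add _ _).symm
    _ ≤ _ := by
        apply Real.exp_le_exp.2
        have h3 : n * Real.exp (-y) * (Real.exp (δ / 2) - 1) ≤ k * (δ / 2 + (δ / 2) ^ 2) := by
          gcongr
        nlinarith

theorem measure_numAbove_le_le (hX : ∀ i, Measurable (X i)) (hindep : iIndepFun X P)
    (hexp : ∀ i, P.map (X i) = expMeasure 1) {n : ℕ} {y k δ : ℝ} (hy : 0 ≤ y) (hδ : 0 < δ)
    (hδ1 : δ ≤ 1) (hk : k ≤ n * Real.exp (-y)) :
    P.real {ω | (numAbove (fun i => X i ω) n y : ℝ) ≤ (1 - δ) * k} ≤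
      Real.exp (-(δ ^ 2 / 4 * k)) := by
  refine (measure_le_le_exp_mul_mgf (t := -(δ / 2)) _ (by linarith)
    (integrable_exp_mul_numAbove hX n y _)).trans ?_
  have h1 := mgf_numAbove_le hX hindep hexp n hy (-(δ / 2))
  have h2 : Real.exp (-(δ / 2)) - 1 ≤ -(δ / 2) + (δ / 2) ^ 2 := by
    have := (abs_le.1 (Real.abs_exp_sub_one_sub_id_le (x := -(δ / 2))
      (by rw [abs_neg, abs_of_pos (by positivity)]; linarith))).2
    linarith
  have h0 : -(δ / 2) + (δ / 2) ^ 2 ≤ 0 := by nlinarith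
  calc _ ≤ Real.exp (-(-(δ / 2)) * ((1 - δ) * k)) *
        Real.exp (n * Real.exp (-y) * (Real.exp (-(δ / 2)) - 1)) := by gcongr
    _ = Real.exp (-(-(δ / 2)) * ((1 - δ) * k) +
          n * Real.exp (-y) * (Real.exp (-(δ / 2)) - 1)) := (Real.exp_add _ _).symm
    _ ≤ _ := by
        apply Real.exp_le_exp.2
        have h3 : n * Real.exp (-y) * (Real.exp (-(δ / 2)) - 1) ≤
            n * Real.exp (-y) * (-(δ / 2) + (δ / 2) ^ 2) := by gcongr
        have h4 : n * Real.exp (-y) * (-(δ / 2) + (δ / 2) ^ 2) ≤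
            k * (-(δ / 2) + (δ / 2) ^ 2) := mul_le_mul_of_nonpos_right hk h0
        nlinarith

theorem ae_eventually_not_of_summable {p : ℕ → Ω → Prop} {g : ℕ → ℝ} (hg : Summable g)
    (h : ∀ᶠ j in atTop, P.real {ω | p j ω} ≤ g j) :
    ∀ᵐ ω ∂P, ∀ᶠ j in atTop, ¬ p j ω := by
  obtain ⟨N, hN⟩ := eventually_atTop.1 h
  have h1 : ∑' j, P {ω | p (j + N) ω} ≠ ⊤ := by
    refine ne_top_of_le_ne_top ((summable_nat_add_iff N).2 hg).tsum_ofReal_ne_top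
      (ENNReal.tsum_le_tsum fun j => ?_)
    rw [← ofReal_measureReal]
    exact ENNReal.ofReal_le_ofReal (hN (j + N) (by omega))
  have h2 := measure_setOfPred_frequently_eq_zero h1
  have h3 : ∀ᵐ ω ∂P, ¬ ∃ᶠ j in atTop, p (j + N) ω := by
    rw [ae_iff]; simpa only [not_not] using h2
  filter_upwards [h3] with ω hω
  rw [not_frequently] at hω
  obtain ⟨M, hM⟩ := eventually_atTop.1 hω
  filter_upwards [eventually_ge_atTop (M + N)] with j hj
  have := hM (j - N) (by omega)
  rwa [Nat.sub_add_cancel (by omega)] at this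

/-- The twelfth term of the exponential series gives `k ^ 12 = (k ^ 4) ^ 3`, hence `j ^ 3`; the cube
leaves a summable bound after a union over `j + 1` levels. -/
theorem exp_neg_mul_le {c C k : ℝ} {j : ℕ} (hc : 0 < c) (hC : 0 < C) (hk : 0 < k) (hj : 0 < j)
    (h : (j : ℝ) ≤ C * k ^ 4) :
    Real.exp (-(c * k)) ≤ (Nat.factorial 12 : ℝ) * C ^ 3 / c ^ 12 / (j : ℝ) ^ 3 := by
  have hj0 : (0 : ℝ) < j := by exact_mod_cast hj
  have h1 := Real.pow_div_factorial_le_exp (c * k) (by positivity) 12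
  have h2 : (j : ℝ) ^ 3 ≤ C ^ 3 * k ^ 12 := by
    calc (j : ℝ) ^ 3 ≤ (C * k ^ 4) ^ 3 := by gcongr
      _ = _ := by ring
  rw [Real.exp_neg, inv_le_comm₀ (Real.exp_pos _) (by positivity)]
  refine le_trans ?_ h1
  rw [div_div, inv_div, div_le_div_iff₀ (by positivity) (by positivity)]
  calc c ^ 12 * (j : ℝ) ^ 3 * (Nat.factorial 12 : ℝ)
      ≤ c ^ 12 * (C ^ 3 * k ^ 12) * (Nat.factorial 12 : ℝ) := by gcongr
    _ = _ := by ring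

/-- Control of the tail counts on a grid of times and levels. -/
theorem ae_eventually_grid (hX : ∀ i, Measurable (X i)) (hindep : iIndepFun X P)
    (hexp : ∀ i, P.map (X i) = expMeasure 1) {h δ C : ℝ} (hh : 0 < h) (hδ : 0 < δ)
    (hδ1 : δ ≤ 1) (hC : 0 < C) :
    ∀ᵐ ω ∂P, ∀ᶠ j : ℕ in atTop, ∀ l : ℕ, l ≤ j →
      (j : ℝ) ≤ C * Real.exp ((j - l) * h) ^ 4 →
        (numAbove (fun i => X i ω) ⌊Real.exp (j * h)⌋₊ (l * h) : ℝ) <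
          (1 + δ) * Real.exp ((j - l) * h) ∧
        (1 - δ) * Real.exp ((j - l) * h) <
          (numAbove (fun i => X i ω) ⌈Real.exp (j * h)⌉₊ (l * h) : ℝ) := by
  -- Rounding down for the upper deviation and up for the lower one puts the true mean on the
  -- favourable side of `exp ((j - l) * h)`.
  set A : ℕ → ℕ → Set Ω := fun j l =>
    {ω | (1 + δ) * Real.exp ((j - l) * h) ≤
      numAbove (fun i => X i ω) ⌊Real.exp (j * h)⌋₊ (l * h)} ∪
    {ω | (numAbove (fun i => X i ω) ⌈Real.exp (j * h)⌉₊ (l * h) : ℝ) ≤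
      (1 - δ) * Real.exp ((j - l) * h)} with hA
  set D : ℝ := (Nat.factorial 12 : ℝ) * C ^ 3 / (δ ^ 2 / 4) ^ 12 with hD
  have hD0 : 0 < D := by positivity
  set g : ℕ → ℝ := fun j => 4 * D * (1 / (j : ℝ) ^ 2) with hg
  have hgs : Summable g := (Real.summable_one_div_nat_pow.2 (by norm_num)).mul_left _
  have hAle : ∀ j l : ℕ, 0 < j → (j : ℝ) ≤ C * Real.exp ((j - l) * h) ^ 4 →
      P.real (A j l) ≤ 2 * (D / (j : ℝ) ^ 3) := by
    intro j l hj hjl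
    have hk : Real.exp (j * h) * Real.exp (-(l * h)) = Real.exp ((j - l) * h) := by
      rw [← Real.exp_add]; ring_nf
    have hl : 0 ≤ (l : ℝ) * h := by positivity
    have h1 := measure_numAbove_ge_le hX hindep hexp (n := ⌊Real.exp (j * h)⌋₊) hl hδ hδ1
      (k := Real.exp ((j - l) * h)) (by
        rw [← hk]; gcongr; exact Nat.floor_le (Real.exp_pos _).le)
    have h2 := measure_numAbove_le_le hX hindep hexp (n := ⌈Real.exp (j * h)⌉₊) hl hδ hδ1
      (k := Real.exp ((j - l) * h)) (by
        rw [← hk]; gcongr; exact Nat.le_ceil _)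
    have h3 := exp_neg_mul_le (c := δ ^ 2 / 4) (by positivity) hC (Real.exp_pos _) hj hjl
    rw [← hD] at h3
    have h4 := measureReal_union_le (μ := P)
      {ω | (1 + δ) * Real.exp ((j - l) * h) ≤
        numAbove (fun i => X i ω) ⌊Real.exp (j * h)⌋₊ (l * h)}
      {ω | (numAbove (fun i => X i ω) ⌈Real.exp (j * h)⌉₊ (l * h) : ℝ) ≤
        (1 - δ) * Real.exp ((j - l) * h)}
    calc P.real (A j l) ≤ _ := h4
      _ ≤ 2 * (D / (j : ℝ) ^ 3) := by linarith
  have hbad := ae_eventually_not_of_summable (P := P)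
    (p := fun j ω => ∃ l ∈ Finset.range (j + 1),
      (j : ℝ) ≤ C * Real.exp ((j - l) * h) ^ 4 ∧ ω ∈ A j l) hgs (by
    filter_upwards [eventually_ge_atTop 1] with j hj
    have hj0 : (0 : ℝ) < j := by exact_mod_cast hj
    have hj1 : (1 : ℝ) ≤ j := by exact_mod_cast hj
    have hsub : {ω | ∃ l ∈ Finset.range (j + 1),
        (j : ℝ) ≤ C * Real.exp ((j - l) * h) ^ 4 ∧ ω ∈ A j l} =
        ⋃ l ∈ Finset.range (j + 1),
          {ω | (j : ℝ) ≤ C * Real.exp ((j - l) * h) ^ 4 ∧ ω ∈ A j l} := by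
      ext ω
      simp only [Set.mem_ofPred_eq, Set.mem_iUnion, exists_prop]
    rw [hsub]
    refine (measureReal_biUnion_finset_le _ _).trans ?_
    have hle : ∀ l ∈ Finset.range (j + 1),
        P.real {ω | (j : ℝ) ≤ C * Real.exp ((j - l) * h) ^ 4 ∧ ω ∈ A j l} ≤
          2 * (D / (j : ℝ) ^ 3) := by
      intro l _
      by_cases hc : (j : ℝ) ≤ C * Real.exp ((j - l) * h) ^ 4
      · simpa [hc] using hAle j l hj hc
      · simp [hc]; positivity
    refine (Finset.sum_le_card_nsmul _ _ _ hle).trans ?_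
    rw [Finset.card_range, nsmul_eq_mul, hg]
    push_cast
    calc ((j : ℝ) + 1) * (2 * (D / (j : ℝ) ^ 3)) ≤ (j + j) * (2 * (D / (j : ℝ) ^ 3)) := by
          gcongr
      _ = 4 * D * (1 / (j : ℝ) ^ 2) := by field_simp; ring)
  filter_upwards [hbad] with ω hω
  filter_upwards [hω] with j hj l hl hjl
  have h1 : ω ∉ A j l := fun hmem => hj ⟨l, by simpa using Nat.lt_succ_of_le hl, hjl, hmem⟩
  simpa [hA] using h1

end Probability

/-! ### From the grid to all times and levels -/

/-- Interpolation between the grid points: control of the counts on a grid of mesh `h` gives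
control at all times and levels, up to a factor `exp (2 * h)`. -/
theorem eventually_numAbove_bounds_of_grid {x : ℕ → ℝ} {h δ : ℝ} (hh : 0 < h) (hδ : 0 < δ)
    (hδ1 : δ ≤ 1)
    (hgrid : ∀ᶠ j : ℕ in atTop, ∀ l : ℕ, l ≤ j →
      (j : ℝ) ≤ (2 * Real.exp (8 * h) / h) * Real.exp ((j - l) * h) ^ 4 →
        (numAbove x ⌊Real.exp (j * h)⌋₊ (l * h) : ℝ) < (1 + δ) * Real.exp ((j - l) * h) ∧
        (1 - δ) * Real.exp ((j - l) * h) < (numAbove x ⌈Real.exp (j * h)⌉₊ (l * h) : ℝ)) :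
    ∀ᶠ n : ℕ in atTop, ∀ y : ℝ, 0 ≤ y → Real.log n ≤ (n * Real.exp (-y)) ^ 4 →
      (numAbove x n y : ℝ) ≤ (1 + δ) * Real.exp (2 * h) * (n * Real.exp (-y)) ∧
      (1 - δ) * Real.exp (-(2 * h)) * (n * Real.exp (-y)) ≤ numAbove x n y := by
  have hjtop : Tendsto (fun n : ℕ => ⌊Real.log n / h⌋₊) atTop atTop :=
    tendsto_nat_floor_atTop.comp (tendsto_log_natCast_atTop.atTop_div_const hh)
  have hjtop' : Tendsto (fun n : ℕ => (⌊Real.log n / h⌋₊ : ℝ)) atTop atTop :=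
    tendsto_natCast_atTop_atTop.comp hjtop
  filter_upwards [hjtop.eventually hgrid, ((tendsto_add_atTop_nat 1).comp hjtop).eventually hgrid,
    hjtop'.eventually_ge_atTop 1, hjtop'.eventually_gt_atTop (Real.exp (8 * h) / h),
    eventually_ge_atTop 1] with n hg0 hg1 hj1 hjh hn1 y hy hlog
  have hn0 : (0 : ℝ) < n := by exact_mod_cast hn1
  have hlog0 : 0 ≤ Real.log n := Real.log_nonneg (by exact_mod_cast hn1)
  simp only [Function.comp_apply] at hg1
  set j := ⌊Real.log n / h⌋₊ with hj
  set l := ⌊y / h⌋₊ with hl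
  have hjle : j * h ≤ Real.log n := by
    rw [← le_div_iff₀ hh]; exact Nat.floor_le (by positivity)
  have hjlt : Real.log n < (j + 1) * h := by
    rw [← div_lt_iff₀ hh]; exact Nat.lt_floor_add_one _
  have hlle : l * h ≤ y := by
    rw [← le_div_iff₀ hh]; exact Nat.floor_le (by positivity)
  have hllt : y < (l + 1) * h := by
    rw [← div_lt_iff₀ hh]; exact Nat.lt_floor_add_one _
  have hκ : n * Real.exp (-y) = Real.exp (Real.log n - y) := by
    rw [sub_eq_add_neg, Real.exp_add, Real.exp_log hn0]
  rw [hκ] at hlog ⊢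
  have hnexp : Real.exp (Real.log n) = n := Real.exp_log hn0
  have hE8 : 1 ≤ Real.exp (8 * h) := Real.one_le_exp (by positivity)
  rw [div_lt_iff₀ hh] at hjh
  have hpow : ∀ z : ℝ, Real.exp z ^ 4 = Real.exp (4 * z) := fun z => by
    rw [← Real.exp_nat_mul]; norm_num
  rw [hpow] at hlog
  have hjκ : j * h ≤ Real.exp (4 * (Real.log n - y)) := hjle.trans hlog
  -- Large `n` forces the expected count above `e^{2h}`, so the neighbouring grid levels stay within
  -- `l ≤ j`.
  have hbig : 8 * h < 4 * (Real.log n - y) := Real.exp_lt_exp.1 (hjh.trans_le hjκ)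
  have hlj : l + 1 ≤ j := by
    have : ((l : ℝ) + 1) * h < (j + 1) * h := by linarith
    have := lt_of_mul_lt_mul_right this hh.le
    have h2 : l + 1 < j + 1 := by exact_mod_cast this
    omega
  constructor
  · have h1 := (hg1 l (by omega) ?_).1
    · have h2 : (numAbove x n y : ℝ) ≤ numAbove x ⌊Real.exp ((j + 1 : ℕ) * h)⌋₊ (l * h) := by
        have h3 : n ≤ ⌊Real.exp ((j + 1 : ℕ) * h)⌋₊ := by
          apply Nat.le_floor
          rw [← hnexp]; push_cast
          exact Real.exp_le_exp.2 hjlt.le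
        exact_mod_cast (numAbove_anti_right x n hlle).trans (numAbove_mono_left x (l * h) h3)
      refine h2.trans (h1.le.trans ?_)
      rw [mul_assoc, ← Real.exp_add]
      gcongr
      push_cast
      linarith
    -- The grid point is `(j + 1, l)`; the factor `2` in the grid constant pays for `j + 1 ≤ 2 j`.
    · rw [hpow, div_mul_eq_mul_div, le_div_iff₀ hh]
      have h2 : Real.exp (4 * (Real.log n - y)) ≤ Real.exp (4 * (((j + 1 : ℕ) - l) * h)) := by
        apply Real.exp_le_exp.2; push_cast; linarith
      have h3 : ((j + 1 : ℕ) : ℝ) * h ≤ 2 * (j * h) := by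
        push_cast; nlinarith
      have h4 : 0 < Real.exp (4 * (((j + 1 : ℕ) - l) * h)) := Real.exp_pos _
      nlinarith
  · have h1 := (hg0 (l + 1) hlj ?_).2
    · have h2 : (numAbove x ⌈Real.exp (j * h)⌉₊ ((l + 1 : ℕ) * h) : ℝ) ≤ numAbove x n y := by
        have h3 : ⌈Real.exp (j * h)⌉₊ ≤ n := by
          apply Nat.ceil_le.2
          rw [← hnexp]
          exact Real.exp_le_exp.2 hjle
        have h4 : y ≤ (l + 1 : ℕ) * h := by push_cast; exact hllt.le
        exact_mod_cast (numAbove_mono_left x _ h3).trans (numAbove_anti_right x n h4)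
      refine le_trans (le_trans ?_ h1.le) h2
      rw [mul_assoc, ← Real.exp_add]
      have h5 : 0 ≤ 1 - δ := by linarith
      gcongr
      push_cast
      linarith
    -- At `(j, l + 1)` the expected count can be smaller by `e^{2h}`; its fourth power is the
    -- `e^{8h}` in the grid constant.
    · rw [hpow, div_mul_eq_mul_div, le_div_iff₀ hh]
      have h2 : Real.exp (4 * (Real.log n - y)) ≤
          Real.exp (8 * h) * Real.exp (4 * ((j - (l + 1 : ℕ)) * h)) := by
        rw [← Real.exp_add]
        apply Real.exp_le_exp.2; push_cast; linarith
      have h4 : 0 < Real.exp (8 * h) * Real.exp (4 * ((j - (l + 1 : ℕ)) * h)) := by positivity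
      linarith

theorem exists_mesh {ε : ℝ} (hε : 0 < ε) : ∃ q : ℕ,
    (1 + 1 / ((q : ℝ) + 1)) * Real.exp (2 * (1 / ((q : ℝ) + 1))) ≤ 1 + ε ∧
    1 - ε ≤ (1 - 1 / ((q : ℝ) + 1)) * Real.exp (-(2 * (1 / ((q : ℝ) + 1)))) := by
  have h0 : Tendsto (fun q : ℕ => 1 / ((q : ℝ) + 1)) atTop (𝓝 0) :=
    tendsto_one_div_add_atTop_nhds_zero_nat
  have h1 : Tendsto (fun s : ℝ => (1 + s) * Real.exp (2 * s)) (𝓝 0) (𝓝 1) := by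
    have : Continuous fun s : ℝ => (1 + s) * Real.exp (2 * s) := by fun_prop
    simpa using this.tendsto 0
  have h2 : Tendsto (fun s : ℝ => (1 - s) * Real.exp (-(2 * s))) (𝓝 0) (𝓝 1) := by
    have : Continuous fun s : ℝ => (1 - s) * Real.exp (-(2 * s)) := by fun_prop
    simpa using this.tendsto 0
  obtain ⟨q, hq1, hq2⟩ := (((h1.comp h0).eventually_le_const (by linarith : 1 < 1 + ε)).and
    ((h2.comp h0).eventually_const_le (by linarith : 1 - ε < 1))).exists
  exact ⟨q, hq1, hq2⟩

section Probability

variable {Ω : Type*} [MeasurableSpace Ω] {P : Measure Ω} [IsProbabilityMeasure P]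
  {X : ℕ → Ω → ℝ}

theorem ae_hasUniformTail (hX : ∀ i, Measurable (X i)) (hindep : iIndepFun X P)
    (hexp : ∀ i, P.map (X i) = expMeasure 1) :
    ∀ᵐ ω ∂P, HasUniformTail fun i => X i ω := by
  -- Countably many meshes `1/(q+1)`, serving also as relative error `δ`, yield one null set for all
  -- `ε`.
  have h1 : ∀ᵐ ω ∂P, ∀ q : ℕ, ∀ᶠ n : ℕ in atTop, ∀ y : ℝ, 0 ≤ y →
      Real.log n ≤ (n * Real.exp (-y)) ^ 4 →
      (numAbove (fun i => X i ω) n y : ℝ) ≤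
        (1 + 1 / ((q : ℝ) + 1)) * Real.exp (2 * (1 / ((q : ℝ) + 1))) * (n * Real.exp (-y)) ∧
      (1 - 1 / ((q : ℝ) + 1)) * Real.exp (-(2 * (1 / ((q : ℝ) + 1)))) * (n * Real.exp (-y)) ≤
        numAbove (fun i => X i ω) n y := by
    rw [ae_all_iff]
    intro q
    have hq : 0 < 1 / ((q : ℝ) + 1) := by positivity
    have hq1 : 1 / ((q : ℝ) + 1) ≤ 1 := by
      rw [div_le_one (by positivity)]; linarith [(Nat.cast_nonneg q : (0 : ℝ) ≤ q)]
    filter_upwards [ae_eventually_grid hX hindep hexp hq hq hq1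
      (C := 2 * Real.exp (8 * (1 / ((q : ℝ) + 1))) / (1 / ((q : ℝ) + 1))) (by positivity)]
      with ω hω
    exact eventually_numAbove_bounds_of_grid hq hq hq1 hω
  filter_upwards [h1] with ω hω ε hε
  obtain ⟨q, hq1, hq2⟩ := exists_mesh hε
  filter_upwards [hω q] with n hn y hy hlog
  obtain ⟨h2, h3⟩ := hn y hy hlog
  have hκ : 0 ≤ n * Real.exp (-y) := by positivity
  have h4 := mul_le_mul_of_nonneg_right hq1 hκ
  have h5 := mul_le_mul_of_nonneg_right hq2 hκ
  rw [abs_le]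
  constructor <;> linarith

/-! ### Records and the growth of the number accepted -/

/-- The level used to compare the maxima over the first `2 ^ j ^ 2` and the first
`2 ^ (j + 1) ^ 2` values. -/
def recordLevel (j : ℕ) : ℝ := ((j ^ 2 + j : ℕ) : ℝ) * Real.log 2

theorem recordLevel_nonneg (j : ℕ) : 0 ≤ recordLevel j :=
  mul_nonneg (Nat.cast_nonneg _) (Real.log_nonneg one_le_two)

theorem exp_neg_recordLevel (j : ℕ) : Real.exp (-recordLevel j) = ((2 : ℝ) ^ (j ^ 2 + j))⁻¹ := by
  rw [Real.exp_neg, recordLevel, Real.exp_nat_mul, Real.exp_log two_pos]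

theorem measureReal_numAbove_ne_zero_le (hX : ∀ i, Measurable (X i))
    (hexp : ∀ i, P.map (X i) = expMeasure 1) (n : ℕ) {y : ℝ} (hy : 0 ≤ y) :
    P.real {ω | numAbove (fun i => X i ω) n y ≠ 0} ≤ n * Real.exp (-y) := by
  have h1 : {ω | numAbove (fun i => X i ω) n y ≠ 0} ⊆
      ⋃ i ∈ Finset.range n, {ω | y < X i ω} := by
    intro ω hω
    obtain ⟨i, hi⟩ := Finset.card_ne_zero.1 hω
    rw [Finset.mem_filter] at hi
    exact Set.mem_biUnion hi.1 hi.2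
  refine (measureReal_mono h1 (measure_ne_top _ _)).trans
    ((measureReal_biUnion_finset_le _ _).trans (le_of_eq ?_))
  rw [Finset.sum_congr rfl fun i _ => measureReal_lt_of_map_eq_expMeasure (hX i) (hexp i) hy]
  simp

/-- The expected number of values above the level is `2 ^ (-j)` at the earlier time and `2 ^ (j +
1)` at the later one, so both failure probabilities are summable. -/
theorem ae_eventually_record (hX : ∀ i, Measurable (X i)) (hindep : iIndepFun X P)
    (hexp : ∀ i, P.map (X i) = expMeasure 1) :
    ∀ᵐ ω ∂P, ∀ᶠ j : ℕ in atTop,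
      numAbove (fun i => X i ω) (2 ^ j ^ 2) (recordLevel j) = 0 ∧
      0 < numAbove (fun i => X i ω) (2 ^ (j + 1) ^ 2) (recordLevel j) := by
  have hg : Summable fun j : ℕ => ((1 : ℝ) / 2) ^ j := summable_geometric_two
  have h1 := ae_eventually_not_of_summable (P := P)
    (p := fun j ω => numAbove (fun i => X i ω) (2 ^ j ^ 2) (recordLevel j) ≠ 0) hg
    (Eventually.of_forall fun j => by
      refine (measureReal_numAbove_ne_zero_le hX hexp _ (recordLevel_nonneg j)).trans
        (le_of_eq ?_)
      rw [exp_neg_recordLevel, pow_add]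
      push_cast
      rw [one_div, inv_pow]
      field_simp)
  have h2 := ae_eventually_not_of_summable (P := P)
    (p := fun j ω => numAbove (fun i => X i ω) (2 ^ (j + 1) ^ 2) (recordLevel j) = 0)
    (hg.mul_left 2)
    (Eventually.of_forall fun j => by
      have hk : ((2 ^ (j + 1) ^ 2 : ℕ) : ℝ) * Real.exp (-recordLevel j) = 2 ^ (j + 1) := by
        rw [exp_neg_recordLevel, show (j + 1) ^ 2 = (j ^ 2 + j) + (j + 1) by ring, pow_add]
        push_cast
        field_simp
      -- With `δ = 1` the lower tail bound is the probability of having no such value.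
      have h3 := measure_numAbove_le_le hX hindep hexp (n := 2 ^ (j + 1) ^ 2)
        (recordLevel_nonneg j) one_pos le_rfl hk.ge
      have h4 : {ω | numAbove (fun i => X i ω) (2 ^ (j + 1) ^ 2) (recordLevel j) = 0} ⊆
          {ω | (numAbove (fun i => X i ω) (2 ^ (j + 1) ^ 2) (recordLevel j) : ℝ) ≤
            (1 - 1) * 2 ^ (j + 1)} := by
        intro ω hω
        have : numAbove (fun i => X i ω) (2 ^ (j + 1) ^ 2) (recordLevel j) = 0 := hω
        simp [this]
      refine (measureReal_mono h4 (measure_ne_top _ _)).trans (h3.trans ?_)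
      rw [Real.exp_neg, one_div, inv_pow, ← div_eq_mul_inv, inv_le_comm₀ (Real.exp_pos _)
        (by positivity), inv_div]
      have h5 := Real.add_one_le_exp (1 ^ 2 / 4 * (2 : ℝ) ^ (j + 1))
      have h6 : 1 ^ 2 / 4 * (2 : ℝ) ^ (j + 1) = 2 ^ j / 2 := by rw [pow_succ]; ring
      rw [h6] at h5 ⊢
      linarith)
  filter_upwards [h1, h2] with ω hω1 hω2
  filter_upwards [hω1, hω2] with j h3 h4
  exact ⟨not_not.1 h3, Nat.pos_of_ne_zero h4⟩

/-- Each block from `J` on brings an acceptance, so `M_n ≥ t` when `n` lies between `2 ^ (J+t) ^ 2`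
and `2 ^ (J+t+1) ^ 2`. There `log n ≤ (J+t+1) ^ 2 ≤ 4 t ^ 2 ≤ t ^ 3` once `t ≥ J + 4`. -/
theorem eventually_log_le_numAccepted_pow {r : ℕ → ℕ} (hr : IsRankSequence r) {x : ℕ → ℝ}
    (h : ∀ᶠ j : ℕ in atTop, numAbove x (2 ^ j ^ 2) (recordLevel j) = 0 ∧
      0 < numAbove x (2 ^ (j + 1) ^ 2) (recordLevel j)) :
    ∀ᶠ n : ℕ in atTop, Real.log n ≤ (numAccepted r x n : ℝ) ^ 3 := by
  obtain ⟨J, hJ⟩ := eventually_atTop.1 h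
  have h1 : ∀ t, t ≤ numAccepted r x (2 ^ (J + t) ^ 2) := by
    intro t
    induction t with
    | zero => exact Nat.zero_le _
    | succ t ih =>
      obtain ⟨h2, h3⟩ := hJ (J + t) (by omega)
      have := numAccepted_lt_of_numAbove hr (recordLevel_nonneg _) h2 h3
      rw [← add_assoc]; omega
  filter_upwards [eventually_ge_atTop (2 ^ (2 * J + 4) ^ 2)] with n hn
  have hn0 : n ≠ 0 := by
    have := Nat.one_le_two_pow (n := (2 * J + 4) ^ 2); omega
  set j := Nat.sqrt (Nat.log 2 n) with hj
  have hjJ : 2 * J + 4 ≤ j := by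
    rw [hj, Nat.le_sqrt']
    exact Nat.le_log_of_pow_le (by norm_num) hn
  obtain ⟨t, hjt⟩ : ∃ t, j = J + t := ⟨j - J, by omega⟩
  have ht4 : J + 4 ≤ t := by omega
  have h2 : 2 ^ (J + t) ^ 2 ≤ n := by
    rw [← hjt]
    refine (Nat.pow_le_pow_right (by norm_num) ?_).trans (Nat.pow_log_le_self 2 hn0)
    exact Nat.sqrt_le' _
  have h3 : t ≤ numAccepted r x n := (h1 t).trans (numAccepted_mono r x h2)
  have h4 : n < 2 ^ (J + t + 1) ^ 2 := by
    refine (Nat.lt_pow_succ_log_self (by norm_num) n).trans_le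
      (Nat.pow_le_pow_right (by norm_num) ?_)
    rw [← hjt]
    exact Nat.succ_le_succ_sqrt' _
  have h5 : Real.log n ≤ ((J + t + 1 : ℕ) : ℝ) ^ 2 := by
    have h6 : (n : ℝ) ≤ 2 ^ (J + t + 1) ^ 2 := by exact_mod_cast h4.le
    have h7 := Real.log_le_log (by exact_mod_cast Nat.pos_of_ne_zero hn0) h6
    rw [Real.log_pow] at h7
    have h8 : Real.log 2 ≤ 1 := by linarith [Real.log_two_lt_d9]
    refine h7.trans ?_
    push_cast
    exact mul_le_of_le_one_right (by positivity) h8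
  have h6 : ((J + t + 1 : ℕ) : ℝ) ^ 2 ≤ (t : ℝ) ^ 3 := by
    have h7 : (J + t + 1) ^ 2 ≤ t ^ 3 := by
      calc (J + t + 1) ^ 2 ≤ (2 * t) ^ 2 := Nat.pow_le_pow_left (by omega) 2
        _ = 4 * t ^ 2 := by ring
        _ ≤ t * t ^ 2 := Nat.mul_le_mul_right _ (by omega)
        _ = t ^ 3 := by ring
    exact_mod_cast h7
  refine h5.trans (h6.trans ?_)
  gcongr

/-! ### Almost every sequence is typical -/

/-- The diagonal is null for a product of atomless laws. Ties must be excluded for the count above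
the threshold to be exactly the rank minus one. -/
theorem ae_injective (hX : ∀ i, Measurable (X i)) (hindep : iIndepFun X P)
    (hexp : ∀ i, P.map (X i) = expMeasure 1) :
    ∀ᵐ ω ∂P, Function.Injective fun i => X i ω := by
  have := isProbabilityMeasure_expMeasure one_pos
  have hne : ∀ i j, i ≠ j → ∀ᵐ ω ∂P, X i ω ≠ X j ω := by
    intro i j hij
    have hprod := (indepFun_iff_map_prod_eq_prod_map_map (hX i).aemeasurable
      (hX j).aemeasurable).1 (hindep.indepFun hij)
    rw [hexp i, hexp j] at hprod
    have hdiag : MeasurableSet {p : ℝ × ℝ | p.1 = p.2} :=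
      measurableSet_eq_fun measurable_fst measurable_snd
    have hna : ∀ a : ℝ, expMeasure 1 {a} = 0 := fun a =>
      withDensity_absolutelyContinuous _ _ (measure_singleton a)
    have h0 : (expMeasure 1).prod (expMeasure 1) {p : ℝ × ℝ | p.1 = p.2} = 0 := by
      rw [Measure.measure_prod_null hdiag]
      refine Eventually.of_forall fun a => ?_
      have : Prod.mk a ⁻¹' {p : ℝ × ℝ | p.1 = p.2} = {a} := by ext b; simp [eq_comm]
      change expMeasure 1 (Prod.mk a ⁻¹' {p : ℝ × ℝ | p.1 = p.2}) = 0
      rw [this]; exact hna a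
    rw [← hprod, Measure.map_apply ((hX i).prodMk (hX j)) hdiag] at h0
    rw [ae_iff]
    simpa using h0
  have hall : ∀ᵐ ω ∂P, ∀ i j, i ≠ j → X i ω ≠ X j ω := by
    rw [ae_all_iff]; intro i
    rw [ae_all_iff]; intro j
    by_cases hij : i = j
    · exact Eventually.of_forall fun ω h => absurd hij h
    · filter_upwards [hne i j hij] with ω hω _ using hω
  filter_upwards [hall] with ω hω i j hij
  by_contra h
  exact hω i j h hij

theorem ae_pos (hX : ∀ i, Measurable (X i)) (hexp : ∀ i, P.map (X i) = expMeasure 1) :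
    ∀ᵐ ω ∂P, ∀ i, 0 < X i ω := by
  rw [ae_all_iff]
  intro i
  have h := measureReal_lt_of_map_eq_expMeasure (hX i) (hexp i) (le_refl 0)
  rw [neg_zero, Real.exp_zero] at h
  have hm : MeasurableSet {ω | 0 < X i ω} := measurableSet_lt measurable_const (hX i)
  exact (mem_ae_iff_prob_eq_one hm).2 ((ENNReal.toReal_eq_one_iff _).1 h)

theorem ae_isTypical (hX : ∀ i, Measurable (X i)) (hindep : iIndepFun X P)
    (hexp : ∀ i, P.map (X i) = expMeasure 1) {r : ℕ → ℕ} (hr : IsRankSequence r) :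
    ∀ᵐ ω ∂P, IsTypical r fun i => X i ω := by
  filter_upwards [ae_pos hX hexp, ae_injective hX hindep hexp, ae_hasUniformTail hX hindep hexp,
    ae_eventually_record hX hindep hexp] with ω h1 h2 h3 h4
  exact ⟨h1, h2, h3, eventually_log_le_numAccepted_pow hr h4⟩

end Probability

/-! ### The limit law -/

section LimitLaw

variable {α : ℝ}

theorem limitDensity_nonneg (hα0 : 0 < α) (u : ℝ) : 0 ≤ limitDensity α u := by
  unfold limitDensity; split_ifs <;> positivity

theorem integral_limitDensity_Iic (hα0 : 0 < α) (hα1 : α < 1) (u : ℝ) :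
    IntegrableOn (limitDensity α) (Set.Iic u) ∧
      ∫ v in Set.Iic u, limitDensity α v = limitCDF α u := by
  have hα' : 0 < 1 - α := by linarith
  have hc : 0 < α / (1 - α) := by positivity
  have hneg : ∀ u ≤ 0, IntegrableOn (limitDensity α) (Set.Iic u) ∧
      ∫ v in Set.Iic u, limitDensity α v = limitCDF α u := by
    intro u hu
    have heq : Set.EqOn (limitDensity α) (fun v => α * Real.exp (α / (1 - α) * v))
        (Set.Iic u) := fun v hv => by
      have hv' : v ≤ u := hv
      rw [limitDensity, if_pos (hv'.trans hu)]; ring_nf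
    constructor
    · rw [integrableOn_congr_fun heq measurableSet_Iic]
      exact (integrableOn_exp_mul_Iic hc u).const_mul α
    · rw [setIntegral_congr_fun measurableSet_Iic heq, integral_const_mul,
        integral_exp_mul_Iic hc, limitCDF, if_pos hu]
      field_simp
  rcases le_or_gt u 0 with hu | hu
  · exact hneg u hu
  have heq : Set.EqOn (limitDensity α) (fun v => α * Real.exp (-v)) (Set.Ioc 0 u) :=
    fun v hv => by rw [limitDensity, if_neg (not_le.2 hv.1)]
  have hcont : Continuous fun v : ℝ => α * Real.exp (-v) := by fun_prop
  have hI : IntegrableOn (limitDensity α) (Set.Ioc 0 u) := by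
    rw [integrableOn_congr_fun heq measurableSet_Ioc]
    exact hcont.integrableOn_Ioc
  have hint : ∫ v in Set.Ioc 0 u, limitDensity α v = α - α * Real.exp (-u) := by
    rw [setIntegral_congr_fun measurableSet_Ioc heq, integral_const_mul,
      ← intervalIntegral.integral_of_le hu.le]
    have hd : ∀ v ∈ Set.uIcc 0 u, HasDerivAt (fun v : ℝ => -Real.exp (-v)) (Real.exp (-v)) v := by
      intro v _
      exact (hasDerivAt_neg v).exp.neg.congr_deriv (by simp)
    rw [intervalIntegral.integral_eq_sub_of_hasDerivAt hd
      (Continuous.intervalIntegrable (by fun_prop) _ _)]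
    simp; ring
  obtain ⟨h1, h2⟩ := hneg 0 le_rfl
  rw [← Set.Iic_union_Ioc_eq_Iic hu.le]
  refine ⟨h1.union hI, ?_⟩
  rw [setIntegral_union (Set.Iic_disjoint_Ioc le_rfl) measurableSet_Ioc h1 hI, h2, hint]
  rw [limitCDF, limitCDF, if_pos le_rfl, if_neg (not_le.2 hu)]
  simp

/-- The asymmetric Laplace law. -/
def limitLaw (α : ℝ) : Measure ℝ :=
  volume.withDensity fun u => ENNReal.ofReal (limitDensity α u)

theorem limitLaw_Iic (hα0 : 0 < α) (hα1 : α < 1) (u : ℝ) :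
    limitLaw α (Set.Iic u) = ENNReal.ofReal (limitCDF α u) := by
  obtain ⟨h1, h2⟩ := integral_limitDensity_Iic hα0 hα1 u
  rw [limitLaw, withDensity_apply _ measurableSet_Iic, ← h2,
    ofReal_integral_eq_lintegral_ofReal h1
      (Eventually.of_forall fun v => limitDensity_nonneg hα0 v)]

theorem isProbabilityMeasure_limitLaw (hα0 : 0 < α) (hα1 : α < 1) :
    IsProbabilityMeasure (limitLaw α) := by
  constructor
  have h1 := tendsto_measure_Iic_atTop (limitLaw α)
  simp only [limitLaw_Iic hα0 hα1] at h1
  refine tendsto_nhds_unique h1 ?_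
  rw [← ENNReal.ofReal_one]
  apply ENNReal.tendsto_ofReal
  have h2 : Tendsto (fun u : ℝ => 1 - α * Real.exp (-u)) atTop (𝓝 1) := by
    simpa using (Real.tendsto_exp_neg_atTop_nhds_zero.const_mul α).const_sub 1
  refine h2.congr' ?_
  filter_upwards [eventually_gt_atTop 0] with u hu
  rw [limitCDF, if_neg (not_le.2 hu)]

end LimitLaw

/-- Pointwise convergence of distribution functions implies weak convergence. -/
theorem tendsto_probabilityMeasure_of_tendsto_Iic {ι : Type*} {l : Filter ι}
    [l.IsCountablyGenerated] {μ : ι → ProbabilityMeasure ℝ} {ν : ProbabilityMeasure ℝ}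
    (h : ∀ u, Tendsto (fun i => (μ i : Measure ℝ).real (Set.Iic u)) l
      (𝓝 ((ν : Measure ℝ).real (Set.Iic u)))) : Tendsto μ l (𝓝 ν) := by
  have hIoc : ∀ (κ : ProbabilityMeasure ℝ) {a b : ℝ}, a < b →
      ((κ (Set.Ioc a b) : NNReal) : ℝ) =
        (κ : Measure ℝ).real (Set.Iic b) - (κ : Measure ℝ).real (Set.Iic a) := by
    intro κ a b hab
    have hset : Set.Ioc a b = Set.Iic b \ Set.Iic a := by ext; simp [and_comm]
    rw [hset, ← measureReal_sdiff (Set.Iic_subset_Iic.2 hab.le) measurableSet_Iic]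
    rfl
  refine (isPiSystem_Ioc (id : ℝ → ℝ) id).tendsto_probabilityMeasure_of_tendsto_of_mem ?_ ?_ ?_
  · rintro s ⟨a, b, -, rfl⟩; exact measurableSet_Ioc
  · intro u hu x hx
    obtain ⟨ε, hε, hball⟩ := Metric.isOpen_iff.1 hu x hx
    refine ⟨Set.Ioc (x - ε / 2) (x + ε / 2), ⟨_, _, by simp; linarith, rfl⟩,
      Ioc_mem_nhds (by linarith) (by linarith), fun y hy => hball ?_⟩
    rw [Metric.mem_ball, Real.dist_eq, abs_lt]
    constructor <;> linarith [hy.1, hy.2]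
  · rintro s ⟨a, b, hab, rfl⟩
    simp only [id] at hab ⊢
    rw [← NNReal.tendsto_coe]
    simp only [hIoc _ hab]
    exact (h b).sub (h a)

/-! ### The empirical distribution -/

section Empirical

variable {r : ℕ → ℕ} {x : ℕ → ℝ} {α : ℝ}

theorem empiricalLaw_real_Iic (n : ℕ) (u : ℝ) :
    (empiricalLaw r x n).real (Set.Iic u) =
      (numAcceptedLE r x n (currentThreshold r x n + u) : ℝ) / numAccepted r x n := by
  rw [empiricalLaw, measureReal_ennreal_smul_apply, measureReal_def, Measure.finsetSum_apply]
  have : ∑ i ∈ accepted r x n, Measure.dirac (x i - currentThreshold r x n) (Set.Iic u) =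
      (numAcceptedLE r x n (currentThreshold r x n + u) : ENNReal) := by
    rw [numAcceptedLE, Finset.card_filter]
    push_cast
    refine Finset.sum_congr rfl fun i _ => ?_
    rw [Measure.dirac_apply' _ measurableSet_Iic]
    simp [Set.indicator_apply, add_comm u]
  rw [this]
  simp [div_eq_inv_mul]

theorem isProbabilityMeasure_empiricalLaw {n : ℕ} (h : 0 < numAccepted r x n) :
    IsProbabilityMeasure (empiricalLaw r x n) := by
  constructor
  simp only [empiricalLaw, Measure.smul_apply, Measure.finsetSum_apply, measure_univ,
    Finset.sum_const, nsmul_eq_mul, mul_one, smul_eq_mul]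
  exact ENNReal.inv_mul_cancel (by exact_mod_cast h.ne') (ENNReal.natCast_ne_top _)

theorem integral_empiricalLaw (n : ℕ) (f : ℝ →ᵇ ℝ) :
    ∫ v, f v ∂(empiricalLaw r x n) =
      ∑ i ∈ accepted r x n, 1 / (numAccepted r x n : ℝ) * f (x i - currentThreshold r x n) := by
  rw [empiricalLaw, integral_smul_measure, integral_finsetSum_measure]
  · simp [Finset.mul_sum]
  · intro i _
    exact f.integrable _

theorem IsTypical.tendsto_integral_empiricalLaw (h : IsTypical r x) (hr : IsRankSequence r)
    (hα0 : 0 < α) (hα1 : α < 1) (hα : Tendsto (fun m : ℕ => (r m : ℝ) / m) atTop (𝓝 α))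
    (f : ℝ →ᵇ ℝ) :
    Tendsto (fun n => ∫ v, f v ∂(empiricalLaw r x n)) atTop (𝓝 (∫ v, f v ∂(limitLaw α))) := by
  have hν := isProbabilityMeasure_limitLaw hα0 hα1
  -- With nobody accepted `empiricalLaw` is the zero measure, so an initial segment is dropped to
  -- stay among probability measures.
  obtain ⟨N, hN⟩ := eventually_atTop.1 (h.tendsto_numAccepted.eventually_gt_atTop 0)
  have hpos : ∀ n, 0 < numAccepted r x (n + N) := fun n => by
    exact_mod_cast hN (n + N) (by omega)
  set μ : ℕ → ProbabilityMeasure ℝ := fun n =>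
    ⟨empiricalLaw r x (n + N), isProbabilityMeasure_empiricalLaw (hpos n)⟩
  have hμ : Tendsto μ atTop (𝓝 ⟨limitLaw α, hν⟩) := by
    apply tendsto_probabilityMeasure_of_tendsto_Iic
    intro u
    have h1 := (tendsto_add_atTop_iff_nat N).2 (h.tendsto_empirical_cdf hr hα0 hα1 hα u)
    have h2 : (limitLaw α).real (Set.Iic u) = limitCDF α u := by
      rw [measureReal_def, limitLaw_Iic hα0 hα1, ENNReal.toReal_ofReal]
      rw [← (integral_limitDensity_Iic hα0 hα1 u).2]
      exact integral_nonneg fun v => limitDensity_nonneg hα0 v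
    change Tendsto (fun n => (empiricalLaw r x (n + N)).real (Set.Iic u)) atTop
      (𝓝 ((limitLaw α).real (Set.Iic u)))
    rw [h2]
    simpa only [empiricalLaw_real_Iic] using h1
  rw [← tendsto_add_atTop_iff_nat N]
  exact ProbabilityMeasure.tendsto_iff_forall_integral_tendsto.1 hμ f

end Empirical

/-! ### Measurability -/

/-- `Finset ℕ` is countable, so joint measurability with the accepted set may be checked for each
fixed set. -/
instance finsetMeasurableSpace : MeasurableSpace (Finset ℕ) := ⊤

/-- Measurability is asked only of the values involved, so that the derived results also apply with
the sigma-algebra `sigmaValues X n`. -/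
theorem measurable_kthLargest {Ω : Type*} [MeasurableSpace Ω] {X : ℕ → Ω → ℝ} {S : Finset ℕ}
    (hX : ∀ i ∈ S, Measurable (X i)) {j : ℕ} (hj : 1 ≤ j) :
    Measurable fun ω => kthLargest (fun i => X i ω) S j := by
  by_cases hjS : j ≤ S.card
  · refine measurable_of_Ioi fun y => ?_
    have hcount : Measurable fun ω => ∑ i ∈ S, (Set.Ioi y).indicator (fun _ => (1 : ℕ)) (X i ω) :=
      Finset.measurable_sum _ fun i hi =>
        (measurable_const.indicator measurableSet_Ioi).comp (hX i hi)
    have : (fun ω => kthLargest (fun i => X i ω) S j) ⁻¹' Set.Ioi y =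
        {ω | j ≤ ∑ i ∈ S, (Set.Ioi y).indicator (fun _ => (1 : ℕ)) (X i ω)} := by
      ext ω
      simp only [Set.mem_preimage, Set.mem_Ioi, Set.mem_ofPred_eq]
      rw [lt_kthLargest_iff _ _ hj hjS, Finset.card_filter]
      simp [Set.indicator_apply]
    rw [this]
    exact measurableSet_le measurable_const hcount
  · simp only [kthLargest_of_card_lt _ _ (not_le.1 hjS)]
    exact measurable_const

theorem measurable_threshold {Ω : Type*} [MeasurableSpace Ω] {X : ℕ → Ω → ℝ} {r : ℕ → ℕ}
    (hr : IsRankSequence r) {n : ℕ} (hX : ∀ i < n, Measurable (X i)) {A : Ω → Finset ℕ}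
    (hA : Measurable A) (hAn : ∀ ω, A ω ⊆ Finset.range n) :
    Measurable fun ω => threshold r (fun i => X i ω) (A ω) := by
  -- Intersecting with `range n` keeps out values not known to be measurable; on the accepted set it
  -- changes nothing.
  have h1 : Measurable fun p : Ω × Finset ℕ =>
      kthLargest (fun i => X i p.1) (p.2 ∩ Finset.range n) (r p.2.card) :=
    measurable_from_prod_countable_left fun S =>
      measurable_kthLargest (S := S ∩ Finset.range n) (j := r S.card) (fun i hi => hX i (Finset.mem_range.1 (Finset.mem_inter.1 hi).2)) (hr.one_le _)
  have h2 := h1.comp (measurable_id.prodMk hA)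
  convert h2 using 2 with ω
  simp only [Function.comp_apply, id, Finset.inter_eq_left.2 (hAn ω)]
  rfl

theorem measurable_accepted {Ω : Type*} [MeasurableSpace Ω] {X : ℕ → Ω → ℝ} {r : ℕ → ℕ}
    (hr : IsRankSequence r) {n : ℕ} (hX : ∀ i < n, Measurable (X i)) :
    Measurable fun ω => accepted r (fun i => X i ω) n := by
  induction n with
  | zero => exact measurable_const
  | succ n ih =>
    have hA := ih fun i hi => hX i (by omega)
    have hT := measurable_threshold hr (fun i (hi : i < n) => hX i (by omega)) hA
      fun ω => accepted_subset_range r _ n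
    exact Measurable.ite (measurableSet_lt hT (hX n (Nat.lt_succ_self n)))
      ((measurable_from_top (f := fun S : Finset ℕ => insert n S)).comp hA) hA

theorem measurable_currentThreshold {Ω : Type*} [MeasurableSpace Ω] {X : ℕ → Ω → ℝ} {r : ℕ → ℕ}
    (hr : IsRankSequence r) {n : ℕ} (hX : ∀ i < n, Measurable (X i)) :
    Measurable fun ω => currentThreshold r (fun i => X i ω) n :=
  have hX' : ∀ i < n - 1, Measurable (X i) := fun i hi => hX i (by omega)
  measurable_threshold hr hX' (measurable_accepted hr hX') fun _ => accepted_subset_range r _ _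

/-! ### A uniformly chosen accepted candidate -/

section UniformPick

theorem measurable_sigmaValues {Ω : Type*} {X : ℕ → Ω → ℝ} {n i : ℕ} (hi : i < n) : Measurable[sigmaValues X n] (X i) :=
  (measurable_pi_apply (⟨i, hi⟩ : Fin n)).comp
    (comap_measurable fun ω (i : Fin n) => X i ω)

variable {Ω : Type*} [MeasurableSpace Ω] {P : Measure Ω} [IsProbabilityMeasure P]
  {X : ℕ → Ω → ℝ} {r : ℕ → ℕ}

theorem sigmaValues_le (hX : ∀ i, Measurable (X i)) (n : ℕ) :
    sigmaValues X n ≤ (inferInstance : MeasurableSpace Ω) :=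
  (measurable_pi_iff.2 fun i : Fin n => hX i).comap_le

/-- Indices `k ≥ n` are never accepted, so integrating their zero conditional probability shows they
are almost surely not picked. This makes the decomposition over `K` finite. -/
theorem IsUniformPick.ae_lt (hX : ∀ i, Measurable (X i)) {n : ℕ} {K : Ω → ℕ}
    (hK : Measurable K) (h : IsUniformPick P r X n K) : ∀ᵐ ω ∂P, K ω < n := by
  have h1 : ∀ k, n ≤ k → ∀ᵐ ω ∂P, K ω ≠ k := by
    intro k hk
    have hm : MeasurableSet (K ⁻¹' {k}) := hK (measurableSet_singleton k)
    have h2 := integral_condExp (sigmaValues_le hX n) (μ := P)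
      (f := (K ⁻¹' {k}).indicator fun _ => (1 : ℝ))
    rw [integral_congr_ae (h k), integral_indicator_const _ hm] at h2
    simp only [notMem_accepted_of_le hk, if_false, integral_zero, smul_eq_mul, mul_one] at h2
    rw [ae_iff]
    have h3 := (measureReal_eq_zero_iff (measure_ne_top P _)).1 h2.symm
    simpa [Set.preimage] using h3
  have h2 : ∀ᵐ ω ∂P, ∀ k, n ≤ k → K ω ≠ k := by
    rw [ae_all_iff]; intro k
    by_cases hk : n ≤ k
    · filter_upwards [h1 k hk] with ω hω _ using hω
    · exact Eventually.of_forall fun ω h => absurd h hk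
  filter_upwards [h2] with ω hω
  by_contra hcon
  exact hω (K ω) (not_lt.1 hcon) rfl

/-- On `K = k` with `k < n`, the integrand is a function of the first `n` values. It can be pulled
out of the conditional expectation, which replaces the indicator of `K = k` by the weight of `k` in
the empirical law. -/
theorem IsUniformPick.integral_eq (hX : ∀ i, Measurable (X i)) (hr : IsRankSequence r) {n : ℕ}
    {K : Ω → ℕ} (hK : Measurable K) (h : IsUniformPick P r X n K) (f : ℝ →ᵇ ℝ) :
    ∫ ω, f (X (K ω) ω - currentThreshold r (fun i => X i ω) n) ∂P =
      ∫ ω, ∫ v, f v ∂(empiricalLaw r (fun i => X i ω) n) ∂P := by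
  set g : ℕ → Ω → ℝ := fun k ω => f (X k ω - currentThreshold r (fun i => X i ω) n) with hg
  set G : ℕ → Ω → ℝ := fun k ω => if k ∈ accepted r (fun i => X i ω) n
        then 1 / (numAccepted r (fun i => X i ω) n : ℝ) else 0 with hG
  set I : ℕ → Ω → ℝ := fun k => (K ⁻¹' {k}).indicator fun _ => (1 : ℝ) with hI
  have hm := sigmaValues_le hX n
  have hgm : ∀ k < n, StronglyMeasurable[sigmaValues X n] (g k) := fun k hk =>
    f.continuous.comp_stronglyMeasurable (Measurable.stronglyMeasurable
      ((measurable_sigmaValues hk).sub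
        (@measurable_currentThreshold Ω (sigmaValues X n) X r hr n
          fun i hi => measurable_sigmaValues hi)))
  have hIint : ∀ k, Integrable (I k) P := fun k =>
    (integrable_const 1).indicator (hK (measurableSet_singleton k))
  have hIg : ∀ k < n, Integrable (I k * g k) P := fun k hk =>
    (hIint k).mul_bdd (c := ‖f‖) ((hgm k hk).mono hm).aestronglyMeasurable
      (Eventually.of_forall fun ω => f.norm_coe_le_norm _)
  have hterm : ∀ k < n, P[I k * g k | sigmaValues X n] =ᵐ[P] G k * g k := fun k hk =>
    (condExp_mul_of_stronglyMeasurable_right (hgm k hk) (hIg k hk) (hIint k)).trans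
      ((h k).mul (ae_eq_refl (g k)))
  have hGg : ∀ k < n, Integrable (G k * g k) P := fun k hk =>
    integrable_condExp.congr (hterm k hk)
  have hleft : (fun ω => f (X (K ω) ω - currentThreshold r (fun i => X i ω) n)) =ᵐ[P]
      fun ω => ∑ k ∈ Finset.range n, (I k * g k) ω := by
    filter_upwards [h.ae_lt hX hK] with ω hω
    rw [Finset.sum_eq_single (K ω)]
    · simp [hI, hg]
    · intro k _ hk
      simp [hI, Ne.symm hk]
    · intro hk
      exact absurd (Finset.mem_range.2 hω) hk
  have hright : ∀ ω, ∫ v, f v ∂(empiricalLaw r (fun i => X i ω) n) =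
      ∑ k ∈ Finset.range n, (G k * g k) ω := by
    intro ω
    rw [integral_empiricalLaw, ← Finset.sum_subset (accepted_subset_range r (fun i => X i ω) n)]
    · refine Finset.sum_congr rfl fun k hk => ?_
      simp [hG, hg, hk]
    · intro k _ hk
      simp [hG, hk]
  rw [integral_congr_ae hleft, integral_finsetSum _ fun k hk => hIg k (Finset.mem_range.1 hk)]
  simp only [hright]
  rw [integral_finsetSum _ fun k hk => hGg k (Finset.mem_range.1 hk)]
  refine Finset.sum_congr rfl fun k hk => ?_
  rw [← integral_congr_ae (hterm k (Finset.mem_range.1 hk)), integral_condExp hm]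

theorem measurable_integral_empiricalLaw (hX : ∀ i, Measurable (X i)) (hr : IsRankSequence r)
    (n : ℕ) (f : ℝ →ᵇ ℝ) :
    Measurable fun ω => ∫ v, f v ∂(empiricalLaw r (fun i => X i ω) n) := by
  have hT := measurable_currentThreshold hr (n := n) fun i _ => hX i
  set Y : Ω → ℝ := fun ω => currentThreshold r (fun i => X i ω) n with hY
  have h1 : Measurable fun p : Ω × Finset ℕ =>
      ∑ i ∈ p.2, 1 / (p.2.card : ℝ) * f (X i p.1 - Y p.1) := by
    refine measurable_from_prod_countable_left fun S => ?_
    have h2 : ∀ i, Measurable fun ω => f (X i ω - Y ω) := fun i =>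
      f.continuous.measurable.comp ((hX i).sub hT)
    exact Finset.measurable_sum S fun i _ => (h2 i).const_mul (1 / (S.card : ℝ))
  have h3 := h1.comp (measurable_id.prodMk
    (measurable_accepted hr (n := n) fun i _ => hX i))
  have h4 : (fun ω => ∫ v, f v ∂(empiricalLaw r (fun i => X i ω) n)) = fun ω =>
      ∑ i ∈ accepted r (fun i => X i ω) n,
        1 / ((accepted r (fun i => X i ω) n).card : ℝ) * f (X i ω - Y ω) := by
    ext ω
    rw [integral_empiricalLaw, numAccepted]
  rw [h4]
  exact h3

theorem norm_integral_empiricalLaw_le {x : ℕ → ℝ} (n : ℕ) (f : ℝ →ᵇ ℝ) :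
    ‖∫ v, f v ∂(empiricalLaw r x n)‖ ≤ ‖f‖ := by
  rcases Nat.eq_zero_or_pos (numAccepted r x n) with h0 | h0
  · have : accepted r x n = ∅ := Finset.card_eq_zero.1 h0
    rw [integral_empiricalLaw, this]; simp
  · have := isProbabilityMeasure_empiricalLaw h0
    simpa using f.norm_integral_le_mul_norm (empiricalLaw r x n)

theorem measurable_apply_index (hX : ∀ i, Measurable (X i)) {K : Ω → ℕ} (hK : Measurable K) :
    Measurable fun ω => X (K ω) ω := by
  have h1 : Measurable fun p : Ω × ℕ => X p.2 p.1 :=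
    measurable_from_prod_countable_left fun k => hX k
  exact h1.comp (measurable_id.prodMk hK)

end UniformPick

end Hiring

end

/-! ### Assembly -/

theorem mainTheorem10 {Ω : Type*} [MeasurableSpace Ω] (P : Measure Ω) [IsProbabilityMeasure P]
    (X : ℕ → Ω → ℝ) (hX : ∀ i, Measurable (X i)) (hindep : iIndepFun X P)
    (hexp : ∀ i, P.map (X i) = expMeasure 1)
    (r : ℕ → ℕ) (hr : Hiring.IsRankSequence r) (α : ℝ) (hα0 : 0 < α) (hα1 : α < 1)
    (hsum : Summable fun m : ℕ => |1 / (r (m + 1) : ℝ) - 1 / (α * ((m + 1 : ℕ) : ℝ))|) :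
    (∀ᵐ ω ∂P, ∀ u : ℝ,
      Tendsto (fun n : ℕ =>
          (Hiring.numAcceptedLE r (fun i => X i ω) n
              (Hiring.currentThreshold r (fun i => X i ω) n + u) : ℝ) /
            (Hiring.numAccepted r (fun i => X i ω) n : ℝ))
        atTop (𝓝 (Hiring.limitCDF α u))) ∧
    ∃ ν : ProbabilityMeasure ℝ,
      (∀ u : ℝ, (ν : Measure ℝ) (Set.Iic u) = ENNReal.ofReal (Hiring.limitCDF α u)) ∧
      (ν : Measure ℝ) = volume.withDensity (fun u => ENNReal.ofReal (Hiring.limitDensity α u)) ∧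
      (∀ᵐ ω ∂P, ∀ f : ℝ →ᵇ ℝ,
        Tendsto (fun n : ℕ => ∫ v, f v ∂(Hiring.empiricalLaw r (fun i => X i ω) n))
          atTop (𝓝 (∫ v, f v ∂(ν : Measure ℝ)))) ∧
      (∀ K : ℕ → Ω → ℕ, (∀ n, Measurable (K n)) →
        (∀ n, 1 ≤ n → Hiring.IsUniformPick P r X n (K n)) →
        TendstoInDistribution
          (fun (n : ℕ) (ω : Ω) =>
            X (K n ω) ω - Hiring.currentThreshold r (fun i => X i ω) n)
          atTop (fun v : ℝ => v) (fun _ => P) (ν : Measure ℝ)) := by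
  have hα := hr.tendsto_div hα0 hα1 hsum
  have htyp := Hiring.ae_isTypical hX hindep hexp hr
  obtain ⟨ν, hν⟩ : ∃ ν : ProbabilityMeasure ℝ, (ν : Measure ℝ) = Hiring.limitLaw α :=
    ⟨⟨_, Hiring.isProbabilityMeasure_limitLaw hα0 hα1⟩, rfl⟩
  have hemp : ∀ᵐ ω ∂P, ∀ f : ℝ →ᵇ ℝ,
      Tendsto (fun n : ℕ => ∫ v, f v ∂(Hiring.empiricalLaw r (fun i => X i ω) n))
        atTop (𝓝 (∫ v, f v ∂(Hiring.limitLaw α))) := by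
    filter_upwards [htyp] with ω hω f
    exact hω.tendsto_integral_empiricalLaw hr hα0 hα1 hα f
  have hcdf := Hiring.limitLaw_Iic hα0 hα1
  rw [← hν] at hemp hcdf
  refine ⟨?_, ν, hcdf, hν, hemp, ?_⟩
  · filter_upwards [htyp] with ω hω u
    exact hω.tendsto_empirical_cdf hr hα0 hα1 hα u
  · intro K hK hpick
    have hZ : ∀ n, Measurable fun ω =>
        X (K n ω) ω - Hiring.currentThreshold r (fun i => X i ω) n := fun n =>
      (Hiring.measurable_apply_index hX (hK n)).sub
        (Hiring.measurable_currentThreshold hr fun i _ => hX i)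
    refine ⟨fun n => (hZ n).aemeasurable, measurable_id.aemeasurable, ?_⟩
    refine ProbabilityMeasure.tendsto_iff_forall_integral_tendsto.2 fun f => ?_
    -- The law of the picked difference is the mean of the random empirical law, so almost sure weak
    -- convergence passes to it by dominated convergence with bound `‖f‖`.
    have hlim : Tendsto
        (fun n => ∫ ω, ∫ v, f v ∂(Hiring.empiricalLaw r (fun i => X i ω) n) ∂P) atTop
        (𝓝 (∫ _ω, ∫ v, f v ∂(ν : Measure ℝ) ∂P)) := by
      refine tendsto_integral_of_dominated_convergence (fun _ => ‖f‖)
        (fun n => (Hiring.measurable_integral_empiricalLaw hX hr n f).aestronglyMeasurable)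
        (integrable_const _)
        (fun n => Eventually.of_forall fun ω => Hiring.norm_integral_empiricalLaw_le n f) ?_
      filter_upwards [hemp] with ω hω using hω f
    rw [integral_const, probReal_univ, one_smul] at hlim
    have hmapid : ∫ v, f v ∂((ν : Measure ℝ).map fun v : ℝ => v) =
        ∫ v, f v ∂(ν : Measure ℝ) := by rw [Measure.map_id']
    change Tendsto (fun n => ∫ v, f v ∂(P.map fun ω =>
      X (K n ω) ω - Hiring.currentThreshold r (fun i => X i ω) n)) atTop
      (𝓝 (∫ v, f v ∂((ν : Measure ℝ).map fun v : ℝ => v)))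
    rw [hmapid]
    refine hlim.congr' ?_
    filter_upwards [eventually_ge_atTop 1] with n hn
    rw [integral_map (hZ n).aemeasurable f.continuous.aestronglyMeasurable,
      (hpick n hn).integral_eq hX hr (hK n) f]
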